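/- **Definitions.** Let $(\bar M,\bar h)$ be a smooth $3$-dimensional Riemannian manifold and $\mathscr K$ a smooth $(1,1)$-tensor field on $\bar M$. Then $(\bar M,\bar h,\mathscr K)$ are *non-degenerate quiescent vacuum initial data on the singularity* if 1. $\mathrm{tr}\,\mathscr K=1$ and $\mathscr K$ is symmetric with respect to $\bar h$, i.e. $\bar h(\mathscr K\xi,\zeta)=\bar h(\xi,\mathscr K\zeta)$; 2. $\mathrm{tr}\,\mathscr K^2=1$ and $\mathrm{div}_{\bar h}\mathscr K=0$; 3. the eigenvalues of $\mathscr K$ are distinct; 4. $(\gamma^1_{23})^2=0$ on $\bar M$, where $p_1<p_2<p_3$ are the eigenvalues of $\mathscr K$, $\mathscr X_A$ is a (local) smooth eigenvector field for $p_A$ with $|\mathscr X_A|_{\bar h}=1$, and $[\mathscr X_B,\mathscr X_C]=\sum_A\gamma^A_{BC}\mathscr X_A$. Given local coordinates $(V,\bar{\mathsf x})$, functions $p_i$ and $c_{ij}$ ($i,j=1,2,3$) on $V$ are *Fournodavlos–Luk data on $V$* if they are smooth, $c_{ij}=c_{ji}$, $p_1<p_2<p_3$, $c_{11},c_{22},c_{33}>0$,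 $\sum_ip_i=\sum_ip_i^2=1$, and, for $i=1,2,3$, $$\sum_{l=1}^{3}\Big[\frac{\partial_ic_{ll}}{c_{ll}}(p_l-p_i)+2\partial_l\kappa_i{}^l+\mathbf 1_{\{l>i\}}\frac{\partial_l(c_{11}c_{22}c_{33})}{c_{11}c_{22}c_{33}}\kappa_i{}^l\Big]=0,\qquad(\ast)$$ where $\kappa_i{}^i=-p_i$ (no summation), $\kappa_i{}^l=0$ if $l<i$, and $$\kappa_1{}^2=(p_1-p_2)\tfrac{c_{12}}{c_{22}},\quad \kappa_2{}^3=(p_2-p_3)\tfrac{c_{23}}{c_{33}},\quad \kappa_1{}^3=(p_2-p_1)\tfrac{c_{12}c_{23}}{c_{22}c_{33}}+(p_1-p_3)\tfrac{c_{13}}{c_{33}}.$$ Let $\mathscr K$ have eigenvalues $p_1<p_2<p_3$ and let $(V,\bar{\mathsf x})$ be local coordinates, with $\mathscr K\partial_i=\sum_j\mathscr K_i{}^j\partial_j$. Put $\bar{\mathscr X}_3=\partial_3$, $\bar{\mathscr X}_2=\partial_2+\bar{\mathscr X}_2^3\partial_3$, $\bar{\mathscr X}_1=\partial_1+\bar{\mathscr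 X}_1^2\partial_2+\bar{\mathscr X}_1^3\partial_3$, where $$\bar{\mathscr X}_1^2=\frac{\mathscr K_1{}^2}{p_1-p_2},\quad \bar{\mathscr X}_2^3=\frac{\mathscr K_2{}^3}{p_2-p_3},\quad \bar{\mathscr X}_1^3=\frac1{p_1-p_3}\Big(\mathscr K_1{}^3+\frac{\mathscr K_1{}^2\mathscr K_2{}^3}{p_1-p_2}\Big).$$ Call the coordinates *adapted* if $\{\bar{\mathscr X}_A\}$ is a smooth frame on $V$ and $\mathscr K\bar{\mathscr X}_A=p_A\bar{\mathscr X}_A$ (no summation) on $V$. Define $c_{ij}=c_{ji}$ by $c_{AA}=\bar h(\bar{\mathscr X}_A,\bar{\mathscr X}_A)$ (no summation) and $$c_{12}=\frac{c_{22}}{p_2-p_1}\mathscr K_1{}^2,\quad c_{23}=\frac{c_{33}}{p_3-p_2}\mathscr K_2{}^3,\quad c_{13}=\frac{c_{33}}{p_3-p_1}\Big(\mathscr K_1{}^3+\frac{\mathscr K_1{}^2\mathscr K_2{}^3}{p_3-p_2}\Big).$$ **Proposition.** (a) Let $(\bar M,\bar h,\mathscr K)$ be non-degenerate quiescent vacuum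 initial data on the singularity, let $p_1<p_2<p_3$ be the eigenvalues of $\mathscr K$, and let $p\in\bar M$. Then there are adapted local coordinates $(V,\bar{\mathsf x})$ with $p\in V$ such that the functions $p_i$ and $c_{ij}$ are Fournodavlos–Luk data on $V$. (b) Let $(\bar M,\bar h)$ be a smooth $3$-dimensional Riemannian manifold and $\mathscr K$ a smooth $(1,1)$-tensor field on $\bar M$ that is symmetric with respect to $\bar h$ and has eigenvalues $p_1<p_2<p_3$ everywhere. In any adapted local coordinates $(V,\bar{\mathsf x})$, and at every point of $V$, condition $(\ast)$ for $i=1,2,3$ is equivalent to $\mathrm{div}_{\bar h}\mathscr K=0$. -/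

import Mathlib

open scoped Manifold ContDiff

noncomputable section

namespace QuiescentData

/-- The model space `ℝ³`. -/
abbrev E3 : Type := EuclideanSpace ℝ (Fin 3)

variable {M : Type*} [TopologicalSpace M] [ChartedSpace E3 M]

/-- The type of (not necessarily continuous) vector fields on `M`. -/
abbrev VField (M : Type*) [TopologicalSpace M] [ChartedSpace E3 M] : Type _ :=
  ∀ x : M, TangentSpace (𝓡 3) x

/-- The type of (not necessarily continuous) `(1,1)`-tensor fields on `M`, i.e. fields of
endomorphisms of the tangent spaces. -/
abbrev EndField (M : Type*) [TopologicalSpace M] [ChartedSpace E3 M] : Type _ :=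
  ∀ x : M, TangentSpace (𝓡 3) x →L[ℝ] TangentSpace (𝓡 3) x

/-- A vector field is smooth on `U`. -/
def SmoothVFieldOn [IsManifold (𝓡 3) ∞ M] (X : VField M) (U : Set M) : Prop :=
  ContMDiffOn (𝓡 3) (𝓡 3).tangent ∞ (fun x => (⟨x, X x⟩ : TangentBundle (𝓡 3) M)) U

/-- A `(1,1)`-tensor field is smooth, as a section of the bundle `Hom(TM, TM)`. -/
def SmoothEndField [IsManifold (𝓡 3) ∞ M] (K : EndField M) : Prop :=
  ContMDiff (𝓡 3) ((𝓡 3).prod 𝓘(ℝ, E3 →L[ℝ] E3)) ∞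
    (fun x => Bundle.TotalSpace.mk' (E3 →L[ℝ] E3)
      (E := fun x : M => TangentSpace (𝓡 3) x →L[ℝ] TangentSpace (𝓡 3) x) x (K x))

/-- A smooth Riemannian metric on `M`. -/
abbrev Metric (M : Type*) [TopologicalSpace M] [ChartedSpace E3 M] [IsManifold (𝓡 3) ∞ M] :
    Type _ :=
  Bundle.ContMDiffRiemannianMetric (𝓡 3) ∞ E3 (fun x : M => TangentSpace (𝓡 3) x)

/-! ### Components in local coordinates

A chart is an `e : OpenPartialHomeomorph M E3` in the maximal smooth atlas; its domain is
`e.source` and its coordinate functions are `x^j = fun y => e y j`. -/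

/-- The coordinate vector field `∂_i` of the chart `e`. -/
def coordVec (e : OpenPartialHomeomorph M E3) (i : Fin 3) : VField M := fun x =>
  (mfderiv (𝓡 3) (𝓡 3) e x).inverse (EuclideanSpace.single i (1 : ℝ) : E3)

/-- The coordinate differential `dx^j` of the chart `e`. -/
def coordCovec (e : OpenPartialHomeomorph M E3) (j : Fin 3) (x : M) :
    TangentSpace (𝓡 3) x →L[ℝ] ℝ :=
  mfderiv (𝓡 3) 𝓘(ℝ, ℝ) (fun y => e y j) x

/-- The partial derivative `∂_i f` of a function in the chart `e`. -/
def pderiv (e : OpenPartialHomeomorph M E3) (i : Fin 3) (f : M → ℝ) (x : M) : ℝ :=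
  fderiv ℝ (fun u => f (e.symm u)) (e x) (EuclideanSpace.single i (1 : ℝ))

/-- The component `K_i^j` in the chart `e`, determined by `K ∂_i = ∑ j, K_i^j ∂_j`. -/
def endComp (e : OpenPartialHomeomorph M E3) (K : EndField M) (i j : Fin 3) (x : M) : ℝ :=
  coordCovec e j x (K x (coordVec e i x))

variable [IsManifold (𝓡 3) ∞ M]

/-- The matrix `(h_ij)` of the metric in the chart `e`. -/
def metricMatrix (e : OpenPartialHomeomorph M E3) (h : Metric M) (x : M) :
    Matrix (Fin 3) (Fin 3) ℝ :=
  Matrix.of fun i j => h.inner x (coordVec e i x) (coordVec e j x)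

/-- The Christoffel symbol `Γ^k_ij` of the Levi-Civita connection of `h` in the chart `e`. -/
def christoffel (e : OpenPartialHomeomorph M E3) (h : Metric M) (k i j : Fin 3) (x : M) : ℝ :=
  1 / 2 * ∑ m, (metricMatrix e h x)⁻¹ k m *
    (pderiv e i (fun y => metricMatrix e h y j m) x
      + pderiv e j (fun y => metricMatrix e h y i m) x
      - pderiv e m (fun y => metricMatrix e h y i j) x)

/-- The component `(div_h K)_j = ∑ i, (∇_i K)_j^i` of the divergence in the chart `e`, with `∇` the
Levi-Civita connection of `h`:
`(∇_i K)_j^i = ∂_i K_j^i + ∑ k, Γ^i_ik K_j^k - ∑ k, Γ^k_ij K_k^i`. -/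
def divComp (e : OpenPartialHomeomorph M E3) (h : Metric M) (K : EndField M) (j : Fin 3) (x : M) :
    ℝ :=
  ∑ i, (pderiv e i (endComp e K j i) x
    + ∑ k, christoffel e h i i k x * endComp e K j k x
    - ∑ k, christoffel e h k i j x * endComp e K k i x)

/-- `div_h K = 0` at the point `x`: in every chart around `x`, all components of the covector
`div_h K` at `x` vanish. -/
def DivFreeAt (h : Metric M) (K : EndField M) (x : M) : Prop :=
  ∀ e ∈ IsManifold.maximalAtlas (𝓡 3) ∞ M, x ∈ e.source → ∀ j, divComp e h K j x = 0

/-! ### Initial data on the singularity (geometric formulation) -/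

/-- `K` is symmetric with respect to `h`. -/
def IsSymm (h : Metric M) (K : EndField M) : Prop :=
  ∀ (x : M) (v w : TangentSpace (𝓡 3) x), h.inner x (K x v) w = h.inner x v (K x w)

/-- `p 0 < p 1 < p 2` are the eigenvalues of `K`, at every point of `M`. -/
def IsOrderedEigenvalues (K : EndField M) (p : Fin 3 → M → ℝ) : Prop :=
  ∀ x : M, (p 0 x < p 1 x ∧ p 1 x < p 2 x) ∧
    ∀ A, Module.End.HasEigenvalue (K x : Module.End ℝ (TangentSpace (𝓡 3) x)) (p A x)

/-- `X 0, X 1, X 2` are smooth `h`-unit eigenvector fields of `K` on `U`, for the eigenvalues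
`p 0, p 1, p 2`. -/
def IsUnitEigenframeOn (h : Metric M) (K : EndField M) (p : Fin 3 → M → ℝ) (X : Fin 3 → VField M)
    (U : Set M) : Prop :=
  ∀ A, SmoothVFieldOn (X A) U ∧
    ∀ x ∈ U, K x (X A x) = p A x • X A x ∧ h.inner x (X A x) (X A x) = 1

/-- `γ A B C` are the structure coefficients of the frame `X` at `x`:
`[X_B, X_C] = ∑ A, γ^A_BC X_A` at `x`. -/
def IsStructureCoeffAt (X : Fin 3 → VField M) (γ : Fin 3 → Fin 3 → Fin 3 → ℝ) (x : M) : Prop :=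
  ∀ B C, VectorField.mlieBracket (𝓡 3) (X B) (X C) x = ∑ A, γ A B C • X A x

/-- Non-degenerate quiescent vacuum initial data on the singularity, on a `3`-manifold. -/
structure IsVacuumData (h : Metric M) (K : EndField M) : Prop where
  smooth : SmoothEndField K
  trace_eq : ∀ x, LinearMap.trace ℝ _ (K x : Module.End ℝ (TangentSpace (𝓡 3) x)) = 1
  symm : IsSymm h K
  trace_sq_eq : ∀ x,
    LinearMap.trace ℝ _ ((K x ∘L K x : TangentSpace (𝓡 3) x →L[ℝ] TangentSpace (𝓡 3) x) :
      Module.End ℝ (TangentSpace (𝓡 3) x)) = 1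
  div_eq_zero : ∀ x, DivFreeAt h K x
  distinct : ∃ p, IsOrderedEigenvalues K p
  /-- `𝒪^1_23 = (γ^1_23)² = 0`; unit eigenvector fields exist locally and are unique up to sign. -/
  obstruction_eq_zero : ∀ p, IsOrderedEigenvalues K p →
    ∀ (U : Set M) (X : Fin 3 → VField M), IsOpen U → IsUnitEigenframeOn h K p X U →
    ∀ x ∈ U, ∀ γ, IsStructureCoeffAt X γ x → (γ 0 1 2) ^ 2 = 0

/-! ### The triangular frame and the functions `c_ij` -/

/-- The coefficient `X_1^2 = K_1^2 / (p_1 - p_2)`. -/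
def X12 (e : OpenPartialHomeomorph M E3) (K : EndField M) (p : Fin 3 → M → ℝ) (x : M) : ℝ :=
  1 / (p 0 x - p 1 x) * endComp e K 0 1 x

/-- The coefficient `X_2^3 = K_2^3 / (p_2 - p_3)`. -/
def X23 (e : OpenPartialHomeomorph M E3) (K : EndField M) (p : Fin 3 → M → ℝ) (x : M) : ℝ :=
  1 / (p 1 x - p 2 x) * endComp e K 1 2 x

/-- The coefficient `X_1^3 = (K_1^3 + K_1^2 K_2^3 / (p_1 - p_2)) / (p_1 - p_3)`. -/
def X13 (e : OpenPartialHomeomorph M E3) (K : EndField M) (p : Fin 3 → M → ℝ) (x : M) : ℝ :=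
  1 / (p 0 x - p 2 x) *
    (endComp e K 0 2 x + 1 / (p 0 x - p 1 x) * endComp e K 0 1 x * endComp e K 1 2 x)

/-- The vector fields `X_1 = ∂_1 + X_1^2 ∂_2 + X_1^3 ∂_3`, `X_2 = ∂_2 + X_2^3 ∂_3`, `X_3 = ∂_3`. -/
def triFrame (e : OpenPartialHomeomorph M E3) (K : EndField M) (p : Fin 3 → M → ℝ) :
    Fin 3 → VField M :=
  ![fun x => coordVec e 0 x + X12 e K p x • coordVec e 1 x + X13 e K p x • coordVec e 2 x,
    fun x => coordVec e 1 x + X23 e K p x • coordVec e 2 x,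
    fun x => coordVec e 2 x]

/-- On the domain of the chart `e`, the `triFrame` is a smooth frame of eigenvector fields of `K`
for the eigenvalues `p 0, p 1, p 2`. -/
def IsTriangularChart (e : OpenPartialHomeomorph M E3) (K : EndField M) (p : Fin 3 → M → ℝ) :
    Prop :=
  IsLocalFrameOn (𝓡 3) E3 ∞ (triFrame e K p) e.source ∧
    ∀ x ∈ e.source, ∀ A, K x (triFrame e K p A x) = p A x • triFrame e K p A x

/-- The diagonal functions `c_AA = h(X_A, X_A)`. -/
def cDiag (e : OpenPartialHomeomorph M E3) (h : Metric M) (K : EndField M) (p : Fin 3 → M → ℝ)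
    (A : Fin 3) (x : M) : ℝ :=
  h.inner x (triFrame e K p A x) (triFrame e K p A x)

/-- `c_12`. -/
def c12 (e : OpenPartialHomeomorph M E3) (h : Metric M) (K : EndField M) (p : Fin 3 → M → ℝ)
    (x : M) : ℝ :=
  cDiag e h K p 1 x / (p 1 x - p 0 x) * endComp e K 0 1 x

/-- `c_23`. -/
def c23 (e : OpenPartialHomeomorph M E3) (h : Metric M) (K : EndField M) (p : Fin 3 → M → ℝ)
    (x : M) : ℝ :=
  cDiag e h K p 2 x / (p 2 x - p 1 x) * endComp e K 1 2 x

/-- `c_13`. -/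
def c13 (e : OpenPartialHomeomorph M E3) (h : Metric M) (K : EndField M) (p : Fin 3 → M → ℝ)
    (x : M) : ℝ :=
  cDiag e h K p 2 x / (p 2 x - p 0 x) *
    (endComp e K 0 2 x + 1 / (p 2 x - p 1 x) * endComp e K 0 1 x * endComp e K 1 2 x)

/-- The symmetric array `c_ij` (index `0` stands for `1`, and so on). -/
def cFun (e : OpenPartialHomeomorph M E3) (h : Metric M) (K : EndField M) (p : Fin 3 → M → ℝ)
    (i j : Fin 3) (x : M) : ℝ :=
  !![cDiag e h K p 0 x, c12 e h K p x, c13 e h K p x;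
     c12 e h K p x, cDiag e h K p 1 x, c23 e h K p x;
     c13 e h K p x, c23 e h K p x, cDiag e h K p 2 x] i j

/-! ### Fournodavlos and Luk data -/

/-- The array `κ_i^l` determined by `p_i` and `c_ij`. -/
def kappa (p : Fin 3 → M → ℝ) (c : Fin 3 → Fin 3 → M → ℝ) (i l : Fin 3) (x : M) : ℝ :=
  !![-p 0 x, (p 0 x - p 1 x) * (c 0 1 x / c 1 1 x),
        (p 1 x - p 0 x) * (c 0 1 x * c 1 2 x / (c 1 1 x * c 2 2 x))
          + (p 0 x - p 2 x) * (c 0 2 x / c 2 2 x);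
     0, -p 1 x, (p 1 x - p 2 x) * (c 1 2 x / c 2 2 x);
     0, 0, -p 2 x] i l

/-- The momentum-type condition at `x` (all three equations), with derivatives in the chart `e`. -/
def MomentumCondAt (e : OpenPartialHomeomorph M E3) (p : Fin 3 → M → ℝ)
    (c : Fin 3 → Fin 3 → M → ℝ) (x : M) : Prop :=
  ∀ i, ∑ l,
    (pderiv e i (c l l) x / c l l x * (p l x - p i x)
      + 2 * pderiv e l (kappa p c i l) x
      + if i < l then
          pderiv e l (fun y => c 0 0 y * c 1 1 y * c 2 2 y) x / (c 0 0 x * c 1 1 x * c 2 2 x)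
            * kappa p c i l x
        else 0) = 0

/-- The functions `p_i`, `c_ij` are Fournodavlos and Luk initial data on the domain of the
chart `e`. -/
structure IsFLDataOn (e : OpenPartialHomeomorph M E3) (p : Fin 3 → M → ℝ)
    (c : Fin 3 → Fin 3 → M → ℝ) : Prop where
  smooth_p : ∀ i, ContMDiffOn (𝓡 3) 𝓘(ℝ, ℝ) ∞ (p i) e.source
  smooth_c : ∀ i j, ContMDiffOn (𝓡 3) 𝓘(ℝ, ℝ) ∞ (c i j) e.source
  symm : ∀ i j, ∀ x ∈ e.source, c i j x = c j i x
  ordered : ∀ x ∈ e.source, p 0 x < p 1 x ∧ p 1 x < p 2 x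
  pos : ∀ i, ∀ x ∈ e.source, 0 < c i i x
  kasner : ∀ x ∈ e.source, ∑ i, p i x = 1 ∧ ∑ i, p i x ^ 2 = 1
  momentum : ∀ x ∈ e.source, MomentumCondAt e p c x

end QuiescentData

end

/-! Part (b) is a computation. In an adapted chart the matrix of K is upper triangular with diagonal
p_i, and the c_ij are arranged so that κ = -K (`kappa_eq_neg_endComp`). The frame X_B consists of
eigenvectors for distinct eigenvalues, so it is orthogonal and the inverse metric is the sum of X_B
⊗ X_B / c_BB. Contracting the Christoffel symbols with this tensor, and with K with a raised index,
leaves only derivatives of the metric coefficients evaluated on (X_B, X_B). The triangular shape of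
the frame turns these into derivatives of c_BB (`IsTriangularChart.pderiv_cDiag`), and the left side
of (∗) becomes -2 (div K)_i (`momentum_sum_eq`). Because `DivFreeAt` speaks of all charts, the
divergence is also contracted with an eigenframe and rewritten without coordinates as `frameDiv`
(`sum_coordCovec_mul_divComp`); hence one chart decides.

Part (a) needs an adapted chart; the remaining conditions follow from (b), the two trace identities
and smoothness of the eigenvalues. The condition γ^1_23 = 0 makes the planes spanned by X_2 and X_3
involutive, and a Frobenius argument applies (`exists_chart_of_involutive`). After X_3 is
straightened to ∂_3, involutivity says that the slope of the plane field in the first two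
coordinates does not depend on the third, so a planar change of coordinates makes X_2 and X_3
tangent to the level sets of x^1. In such a chart K is triangular
(`IsEigenframeNear.isUpperTriangularAt`), and then the explicit triangular frame consists of
eigenvectors (`IsUpperTriangularAt.end_triFrame`).

The analytic inputs are smooth local eigenvector fields (`exists_smooth_eigenpair`) and the smooth
flow box (`exists_flowBox`). Both rest on the inverse function theorem. For the flow it is applied
in the Banach space of continuous curves to the integral equation γ = x + T ∫ V(γ), whose smoothness
is that of the superposition operator γ ↦ V ∘ γ. -/

set_option linter.unusedSectionVars false

noncomputable section

namespace QuiescentData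

open Filter Topology

/-! ### Superposition operators on spaces of continuous functions -/

section Superposition

variable {S : Type*} [TopologicalSpace S] [CompactSpace S]
variable {E F : Type*} [NormedAddCommGroup E] [NormedSpace ℝ E]
  [NormedAddCommGroup F] [NormedSpace ℝ F]

/-- Pointwise application of a continuous family of continuous linear maps. -/
def pointwiseApply : C(S, E →L[ℝ] F) →L[ℝ] C(S, E) →L[ℝ] C(S, F) :=
  LinearMap.mkContinuous₂
    (LinearMap.mk₂ ℝ
      (fun (A : C(S, E →L[ℝ] F)) (η : C(S, E)) =>
        (⟨fun s => A s (η s), by fun_prop⟩ : C(S, F)))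
      (by intros; ext; simp) (by intros; ext; simp) (by intros; ext; simp) (by intros; ext; simp))
    1 (by
      intro A η
      rw [ContinuousMap.norm_le _ (by positivity)]
      intro s
      rw [one_mul]
      exact ((A s).le_opNorm _).trans (by
        gcongr
        · exact A.norm_coe_le_norm s
        · exact η.norm_coe_le_norm s))

/-- At each `s` the remainder is controlled by the mean value inequality for `f` on a ball about `γ
s`. One radius serves all `s` because it is taken from continuity of `γ ↦ f' ∘ γ` in the supremum
norm. -/
theorem hasFDerivAt_continuousMap_comp {f : E → F} (hf : ContDiff ℝ 1 f) (γ : C(S, E)) :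
    HasFDerivAt (fun γ : C(S, E) => (⟨f, hf.continuous⟩ : C(E, F)).comp γ)
      (pointwiseApply ((⟨fderiv ℝ f, hf.continuous_fderiv one_ne_zero⟩ :
        C(E, E →L[ℝ] F)).comp γ)) γ := by
  set D : C(E, E →L[ℝ] F) := ⟨fderiv ℝ f, hf.continuous_fderiv one_ne_zero⟩ with hD
  rw [hasFDerivAt_iff_isLittleO, Asymptotics.isLittleO_iff]
  intro ε hε
  have hcont : ContinuousAt (fun γ : C(S, E) => D.comp γ) γ :=
    (ContinuousMap.continuous_postcomp D).continuousAt
  obtain ⟨δ, hδ, hball⟩ := (Metric.continuousAt_iff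
    (f := fun γ : C(S, E) => D.comp γ) (a := γ)).1 hcont ε hε
  filter_upwards [Metric.ball_mem_nhds γ hδ] with γ' hγ'
  rw [ContinuousMap.norm_le _ (by positivity)]
  intro s
  have hbound : ∀ y ∈ Metric.ball (γ s) δ, ‖fderiv ℝ f y - fderiv ℝ f (γ s)‖ ≤ ε := by
    intro y hy
    -- Translating the whole map by the constant `y - γ s` stays within `δ` of `γ` and takes the
    -- value `y` at `s`, so the supremum estimate specialises to the bound at `y`.
    have h1 : dist (γ + ContinuousMap.const S (y - γ s)) γ < δ := by
      rw [dist_eq_norm, add_sub_cancel_left]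
      refine lt_of_le_of_lt ?_ (mem_ball_iff_norm.1 hy)
      exact (ContinuousMap.norm_le _ (norm_nonneg _)).2 fun _ => le_rfl
    have h2 := (hball h1).le
    have h3 : dist (D ((γ + ContinuousMap.const S (y - γ s)) s)) (D (γ s)) ≤ ε :=
      (ContinuousMap.dist_apply_le_dist (f := D.comp (γ + ContinuousMap.const S (y - γ s)))
        (g := D.comp γ) s).trans h2
    simpa [hD, dist_eq_norm] using h3
  have hγs : γ' s ∈ Metric.ball (γ s) δ :=
    lt_of_le_of_lt (ContinuousMap.dist_apply_le_dist s) hγ'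
  have h4 := (convex_ball (γ s) δ).norm_image_sub_le_of_norm_fderiv_le' (f := f)
    (fun x _ => (hf.differentiable one_ne_zero) x) hbound (Metric.mem_ball_self hδ) hγs
  refine h4.trans ?_
  gcongr
  exact (γ' - γ).norm_coe_le_norm s

/-- The derivative is superposition by `fderiv ℝ f` followed by the continuous linear map
`pointwiseApply`, which allows induction on `n`. The target changes to `E →L[ℝ] F`, so `F` is
quantified inside the induction and shares a universe with `E`. -/
theorem contDiff_continuousMap_comp {S : Type*} [TopologicalSpace S] [CompactSpace S]
    {E : Type u} [NormedAddCommGroup E] [NormedSpace ℝ E] (n : ℕ) :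
    ∀ {F : Type u} [NormedAddCommGroup F] [NormedSpace ℝ F] {f : E → F} (hf : ContDiff ℝ ∞ f),
      ContDiff ℝ n (fun γ : C(S, E) => (⟨f, hf.continuous⟩ : C(E, F)).comp γ) := by
  induction n with
  | zero =>
    intro F _ _ f hf
    simp only [Nat.cast_zero, contDiff_zero]
    exact ContinuousMap.continuous_postcomp _
  | succ n ih =>
    intro F _ _ f hf
    have hf' : ContDiff ℝ ∞ (fderiv ℝ f) := hf.fderiv_right (m := ∞) (by simp)
    have h1 : ContDiff ℝ 1 f := hf.of_le (by simp)
    push_cast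
    rw [contDiff_succ_iff_hasFDerivAt]
    have hB : ContDiff ℝ n (fun A : C(S, E →L[ℝ] F) => pointwiseApply A) :=
      ContinuousLinearMap.contDiff _
    exact ⟨fun γ => pointwiseApply ((⟨fderiv ℝ f, hf'.continuous⟩ : C(E, E →L[ℝ] F)).comp γ),
      hB.comp (ih hf'),
      fun γ => hasFDerivAt_continuousMap_comp h1 γ⟩

end Superposition

/-! ### The inverse function theorem with smoothness on a neighbourhood -/

section InverseFunction

variable {E F : Type*} [NormedAddCommGroup E] [NormedSpace ℝ E] [CompleteSpace E]
  [NormedAddCommGroup F] [NormedSpace ℝ F]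

/-- Invertible linear maps form an open set, so after shrinking the source the derivative is
invertible throughout and the inverse is smooth at every point of the target. Charts and flows need
this on a neighbourhood, not only at one point. -/
theorem exists_openPartialHomeomorph_of_hasFDerivAt {f : E → F} {a : E} {f' : E ≃L[ℝ] F}
    (hf : ∀ᶠ x in 𝓝 a, ContDiffAt ℝ ∞ f x) (hf' : HasFDerivAt f (f' : E →L[ℝ] F) a) :
    ∃ R : OpenPartialHomeomorph E F, a ∈ R.source ∧ (R : E → F) = f ∧
      (∀ x ∈ R.source, ContDiffAt ℝ ∞ f x) ∧ ∀ y ∈ R.target, ContDiffAt ℝ ∞ R.symm y := by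
  have hfa : ContDiffAt ℝ ∞ f a := hf.self_of_nhds
  set R₀ := hfa.toOpenPartialHomeomorph f hf' (by simp) with hR₀
  have hR₀f : (R₀ : E → F) = f := rfl
  have hinv : ∀ᶠ x in 𝓝 a, fderiv ℝ f x ∈
      Set.range ((↑) : (E ≃L[ℝ] F) → E →L[ℝ] F) := by
    have hc : ContinuousAt (fderiv ℝ f) a := hfa.continuousAt_fderiv (by simp)
    refine hc.eventually_mem ?_
    rw [hf'.fderiv]
    exact ContinuousLinearEquiv.nhds f'
  obtain ⟨U, hU, hUo, haU⟩ := eventually_nhds_iff.1 (hf.and hinv)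
  refine ⟨R₀.restrOpen U hUo, ⟨?_, haU⟩, hR₀f, fun x hx => (hU x hx.2).1, ?_⟩
  · exact hfa.mem_toOpenPartialHomeomorph_source hf' (by simp)
  · intro y hy
    have hs := (R₀.restrOpen U hUo).map_target hy
    obtain ⟨h1, ⟨g, hg⟩⟩ := hU _ hs.2
    refine (R₀.restrOpen U hUo).contDiffAt_symm (f₀' := g) hy ?_ ?_
    · rw [hg]
      exact (h1.differentiableAt (by simp)).hasFDerivAt
    · exact h1

end InverseFunction

/-! ### Smooth local flows -/

section Flow

open unitInterval

variable {E : Type u} [NormedAddCommGroup E] [NormedSpace ℝ E]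

/-- The primitive vanishing at `0` of a curve on the unit interval. -/
def primitiveCLM (E : Type u) [NormedAddCommGroup E] [NormedSpace ℝ E] : C(I, E) →L[ℝ] C(I, E) :=
  LinearMap.mkContinuous
    { toFun := fun γ => ⟨fun s => ∫ t in (0 : ℝ)..s, γ (Set.projIcc 0 1 zero_le_one t), by
        have hc : Continuous fun t => γ (Set.projIcc (0 : ℝ) 1 zero_le_one t) :=
          γ.continuous.comp continuous_projIcc
        exact (intervalIntegral.continuous_primitive (fun a b => hc.intervalIntegrable a b) 0).comp
          continuous_subtype_val⟩
      map_add' := by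
        intro γ η
        ext s
        have hc : ∀ γ : C(I, E), Continuous fun t => γ (Set.projIcc (0 : ℝ) 1 zero_le_one t) :=
          fun γ => γ.continuous.comp continuous_projIcc
        exact intervalIntegral.integral_add ((hc γ).intervalIntegrable _ _)
          ((hc η).intervalIntegrable _ _)
      map_smul' := by
        intro c γ
        ext s
        exact intervalIntegral.integral_smul _ _ }
    1 (by
      intro γ
      rw [one_mul, ContinuousMap.norm_le _ (norm_nonneg _)]
      intro s
      have h := intervalIntegral.norm_integral_le_of_norm_le_const (a := (0 : ℝ)) (b := s)
        (C := ‖γ‖) (f := fun t => γ (Set.projIcc 0 1 zero_le_one t))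
        (fun t _ => γ.norm_coe_le_norm _)
      refine h.trans ?_
      have h0 : |(s : ℝ) - 0| ≤ 1 := by
        rw [sub_zero, abs_of_nonneg s.2.1]; exact s.2.2
      exact mul_le_of_le_one_right (norm_nonneg _) h0)

theorem primitiveCLM_apply (γ : C(I, E)) (s : I) :
    primitiveCLM E γ s = ∫ t in (0 : ℝ)..s, γ (Set.projIcc 0 1 zero_le_one t) := rfl

/-- Constant curves. -/
def constCLM (E : Type u) [NormedAddCommGroup E] [NormedSpace ℝ E] : E →L[ℝ] C(I, E) :=
  LinearMap.mkContinuous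
    { toFun := fun x => ContinuousMap.const I x
      map_add' := fun _ _ => rfl
      map_smul' := fun _ _ => rfl } 1 (by
      intro x
      rw [one_mul]
      exact (ContinuousMap.norm_le _ (norm_nonneg _)).2 fun _ => le_rfl)

@[simp] theorem constCLM_apply (x : E) (s : I) : constCLM E x s = x := rfl

/-- The map whose zeros (in the last component) are the curves solving
`γ' = T V(γ)`, `γ(0) = x`, together with the parameters `(x, T)`. -/
def flowMap (V : C(E, E)) (q : (E × ℝ) × C(I, E)) : (E × ℝ) × C(I, E) :=
  (q.1, q.2 - constCLM E q.1.1 - q.1.2 • primitiveCLM E (V.comp q.2))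

theorem contDiff_flowMap {V : C(E, E)} (hV : ContDiff ℝ ∞ V) :
    ContDiff ℝ ∞ (flowMap V) := by
  have hN : ContDiff ℝ ∞ (fun γ : C(I, E) => V.comp γ) :=
    contDiff_infty.2 fun n => contDiff_continuousMap_comp n hV
  have h1 : ContDiff ℝ ∞ (fun q : (E × ℝ) × C(I, E) => primitiveCLM E (V.comp q.2)) :=
    (primitiveCLM E).contDiff.comp (hN.comp contDiff_snd)
  have h2 : ContDiff ℝ ∞ (fun q : (E × ℝ) × C(I, E) => constCLM E q.1.1) :=
    (constCLM E).contDiff.comp (contDiff_fst.comp contDiff_fst)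
  exact contDiff_fst.prodMk ((contDiff_snd.sub h2).sub
    ((contDiff_snd.comp contDiff_fst).smul h1))

/-- At `T = 0` the factor `T` removes the dependence of the nonlinear term on the curve. The
differential is therefore block triangular with identity blocks on the diagonal, hence invertible.
-/
theorem hasFDerivAt_flowMap {V : C(E, E)} (hV : ContDiff ℝ ∞ V) (x : E) :
    HasFDerivAt (flowMap V)
      (((ContinuousLinearEquiv.refl ℝ (E × ℝ)).skewProd (ContinuousLinearEquiv.refl ℝ C(I, E))
        (-(constCLM E ∘L ContinuousLinearMap.fst ℝ E ℝ) -
          (ContinuousLinearMap.snd ℝ E ℝ).smulRight (primitiveCLM E (constCLM E (V x)))) :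
        ((E × ℝ) × C(I, E)) ≃L[ℝ] _) : ((E × ℝ) × C(I, E)) →L[ℝ] _)
      ((x, 0), constCLM E x) := by
  have hN : ContDiff ℝ ∞ (fun γ : C(I, E) => V.comp γ) :=
    contDiff_infty.2 fun n => contDiff_continuousMap_comp n hV
  have h1 : ContDiff ℝ ∞ (fun q : (E × ℝ) × C(I, E) => primitiveCLM E (V.comp q.2)) :=
    (primitiveCLM E).contDiff.comp (hN.comp contDiff_snd)
  have h1' := ((h1.differentiable (by simp)) ((x, 0), constCLM E x)).hasFDerivAt
  have hfst : HasFDerivAt (fun q : (E × ℝ) × C(I, E) => q.1) (ContinuousLinearMap.fst ℝ _ _)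
    ((x, 0), constCLM E x) := hasFDerivAt_fst
  have hsnd : HasFDerivAt (fun q : (E × ℝ) × C(I, E) => q.2) (ContinuousLinearMap.snd ℝ _ _)
    ((x, 0), constCLM E x) := hasFDerivAt_snd
  have hc := (constCLM E).hasFDerivAt.comp ((x, 0), constCLM E x)
    (hasFDerivAt_fst.comp ((x, 0), constCLM E x) hfst)
  have hT := (hasFDerivAt_snd.comp ((x, 0), constCLM E x) hfst).smul h1'
  refine (hfst.prodMk ((hsnd.sub hc).sub hT)).congr_fderiv ?_
  have hVc : V.comp (constCLM E x) = constCLM E (V x) := rfl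
  refine ContinuousLinearMap.ext fun q => ?_
  refine Prod.ext rfl ?_
  simp [hVc]
  abel

/-- Restriction of a curve to `[0, r]`, reparametrised by the unit interval. -/
def rescale (r : I) (γ : C(I, E)) : C(I, E) :=
  γ.comp ⟨fun s => r * s, by fun_prop⟩

/-- Substitution `t ↦ r * t` in the integral. Together with local injectivity of `flowMap` it
identifies the flow at time `r * T` with `γ r`, so that the parameter `T` becomes the time along one
curve. -/
theorem flowMap_rescale {V : C(E, E)} {x : E} {T : ℝ} {γ : C(I, E)}
    (h : flowMap V ((x, T), γ) = ((x, T), 0)) (r : I) :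
    flowMap V ((x, r * T), rescale r γ) = ((x, r * T), 0) := by
  have h' : ∀ s : I, γ s = x + T • ∫ t in (0 : ℝ)..s, V (γ (Set.projIcc 0 1 zero_le_one t)) := by
    intro s
    have h2 := congrArg (fun q : (E × ℝ) × C(I, E) => q.2 s) h
    simp only [flowMap, ContinuousMap.sub_apply, ContinuousMap.smul_apply, constCLM_apply,
      ContinuousMap.zero_apply, primitiveCLM_apply, ContinuousMap.comp_apply] at h2
    rw [sub_sub, sub_eq_zero] at h2
    exact h2
  refine Prod.ext rfl ?_
  ext s
  simp only [flowMap, ContinuousMap.sub_apply, ContinuousMap.smul_apply, constCLM_apply,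
      ContinuousMap.zero_apply, primitiveCLM_apply, ContinuousMap.comp_apply, rescale,
      ContinuousMap.coe_mk]
  rw [sub_sub, sub_eq_zero, h' (r * s), mul_comm (r : ℝ) T, mul_smul]
  congr 2
  have h3 := intervalIntegral.smul_integral_comp_mul_left (a := (0 : ℝ)) (b := s)
    (fun t => V (γ (Set.projIcc 0 1 zero_le_one t))) (r : ℝ)
  rw [mul_zero] at h3
  rw [Set.Icc.coe_mul, ← h3]
  congr 1
  refine intervalIntegral.integral_congr fun t ht => ?_
  rw [Set.uIcc_of_le s.2.1] at ht
  have ht1 : t ∈ Set.Icc (0 : ℝ) 1 := ⟨ht.1, ht.2.trans s.2.2⟩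
  have e1 : Set.projIcc (0 : ℝ) 1 zero_le_one (r * t) = r * ⟨t, ht1⟩ := by
    apply Subtype.ext
    rw [Set.projIcc_of_mem _ (show (r : ℝ) * t ∈ Set.Icc (0 : ℝ) 1 from (r * ⟨t, ht1⟩ : I).2)]
    rfl
  simp only [e1, Set.projIcc_of_mem _ ht1]

/-- Solutions up to time `T` are reparametrised by the unit interval, so that all of them live in
the one Banach space `C(I, E)` and `T` is a parameter like the initial point. Joint smoothness then
comes from inverting `flowMap` and evaluating at the endpoint `1`. -/
theorem exists_smooth_flow_of_contDiff [CompleteSpace E] {V : E → E} (hV : ContDiff ℝ ∞ V)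
    (x₀ : E) :
    ∃ φ : E × ℝ → E, (∀ᶠ z in 𝓝 (x₀, (0 : ℝ)), ContDiffAt ℝ ∞ φ z) ∧
      (∀ᶠ z in 𝓝 (x₀, (0 : ℝ)), φ (z.1, 0) = z.1 ∧
        HasDerivAt (fun t => φ (z.1, t)) (V (φ z)) z.2) := by
  set W : C(E, E) := ⟨V, hV.continuous⟩ with hW
  obtain ⟨R, haR, hRf, -, hRs⟩ := exists_openPartialHomeomorph_of_hasFDerivAt
    (Eventually.of_forall fun q => (contDiff_flowMap (V := W) hV).contDiffAt)
    (hasFDerivAt_flowMap (V := W) hV x₀)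
  set a : (E × ℝ) × C(I, E) := ((x₀, 0), constCLM E x₀) with ha
  have hGa : flowMap W a = ((x₀, 0), 0) := by
    simp [flowMap, ha]
  obtain ⟨ε, hε, hball⟩ := Metric.isOpen_iff.1 R.open_source a haR
  have hat : ((x₀, (0 : ℝ)), (0 : C(I, E))) ∈ R.target := by
    rw [← hGa, ← hRf]; exact R.map_source haR
  have hsa : R.symm ((x₀, (0 : ℝ)), (0 : C(I, E))) = a := by
    rw [← hGa, ← hRf, R.left_inv haR]
  have hemb : Continuous fun z : E × ℝ => (z, (0 : C(I, E))) := by fun_prop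
  have hgood : ∀ᶠ z in 𝓝 (x₀, (0 : ℝ)), (z, (0 : C(I, E))) ∈ R.target ∧
      R.symm (z, 0) ∈ Metric.ball a ε := by
    have h1 : ContinuousAt (fun z : E × ℝ => (z, (0 : C(I, E)))) (x₀, 0) := hemb.continuousAt
    have h2 : ContinuousAt (fun z : E × ℝ => R.symm (z, (0 : C(I, E)))) (x₀, 0) :=
      ContinuousAt.comp (g := R.symm) (R.continuousAt_symm hat) h1
    refine (h1.eventually_mem (R.open_target.mem_nhds hat)).and (h2.eventually_mem ?_)
    rw [hsa]
    exact Metric.ball_mem_nhds a hε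
  set φ : E × ℝ → E := fun z => (R.symm (z, 0)).2 1 with hφ
  have hsmooth : ∀ z : E × ℝ, (z, (0 : C(I, E))) ∈ R.target → ContDiffAt ℝ ∞ φ z := by
    intro z hz
    have h1 : ContDiffAt ℝ ∞ (fun z : E × ℝ => R.symm (z, (0 : C(I, E)))) z :=
      (hRs _ hz).comp z (contDiffAt_id.prodMk contDiffAt_const)
    have h2 : ContDiff ℝ ∞ (fun γ : C(I, E) => γ 1) :=
      (ContinuousMap.evalCLM ℝ (1 : I) : C(I, E) →L[ℝ] E).contDiff
    exact h2.contDiffAt.comp z (contDiffAt_snd.comp z h1)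
  -- the curve through `(x, T)` and its rescalings
  have hcurve : ∀ z : E × ℝ, (z, (0 : C(I, E))) ∈ R.target → R.symm (z, 0) ∈ Metric.ball a ε →
      ∃ γ : C(I, E), (∀ r : I, φ (z.1, r * z.2) = γ r) ∧
        ∀ r : I, γ r = z.1 + z.2 • ∫ t in (0 : ℝ)..r, V (γ (Set.projIcc 0 1 zero_le_one t)) := by
    rintro ⟨x, T⟩ hz hb
    have hfl : flowMap W (R.symm ((x, T), 0)) = ((x, T), 0) := by
      rw [← hRf]; exact R.right_inv hz
    obtain ⟨γ, hγ⟩ : ∃ γ, R.symm ((x, T), 0) = ((x, T), γ) :=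
      ⟨(R.symm ((x, T), 0)).2, Prod.ext (congrArg (fun q => q.1) hfl :) rfl⟩
    rw [hγ] at hfl hb
    refine ⟨γ, fun r => ?_, fun s => ?_⟩
    · have hr := flowMap_rescale hfl r
      -- Injectivity is available only on `R.source`, which contains this ball. Rescaling does not
      -- leave the ball: it only shortens the time and restricts the curve to part of its values.
      have hmem : ((x, r * T), rescale r γ) ∈ Metric.ball a ε := by
        rw [Metric.mem_ball, ha, Prod.dist_eq, Prod.dist_eq, max_lt_iff, max_lt_iff] at hb ⊢
        obtain ⟨⟨hb1, hb2⟩, hb3⟩ := hb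
        refine ⟨⟨hb1, lt_of_le_of_lt ?_ hb2⟩, lt_of_le_of_lt ?_ hb3⟩
        · simp only [dist_zero_right, norm_mul, Real.norm_eq_abs, abs_of_nonneg r.2.1]
          exact mul_le_of_le_one_left (abs_nonneg _) r.2.2
        · exact (ContinuousMap.dist_le dist_nonneg).2 fun s =>
            ContinuousMap.dist_apply_le_dist (f := γ) (g := constCLM E x₀) (r * s)
      have h3 : R.symm ((x, r * T), 0) = ((x, r * T), rescale r γ) := by
        rw [← hr, ← hRf, R.left_inv (hball hmem)]
      simp [hφ, h3, rescale]
    · have h2 := congrArg (fun q : (E × ℝ) × C(I, E) => q.2 s) hfl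
      simp only [flowMap, ContinuousMap.sub_apply, ContinuousMap.smul_apply, constCLM_apply,
        ContinuousMap.zero_apply, primitiveCLM_apply, ContinuousMap.comp_apply] at h2
      rw [sub_sub, sub_eq_zero] at h2
      exact h2
  have hinit : ∀ z : E × ℝ, (z, (0 : C(I, E))) ∈ R.target → R.symm (z, 0) ∈ Metric.ball a ε →
      φ (z.1, 0) = z.1 := by
    intro z h1 h2
    obtain ⟨γ, hγ1, hγ2⟩ := hcurve z h1 h2
    have := hγ1 0
    rw [hγ2 0] at this
    simpa using this
  -- The curve for the doubled time is used so that `z.2` sits at parameter `1 / 2`, inside the unit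
  -- interval, where the two-sided derivative follows from the fundamental theorem of calculus.
  have hderiv : ∀ z : E × ℝ, ((z.1, 2 * z.2), (0 : C(I, E))) ∈ R.target →
      R.symm ((z.1, 2 * z.2), 0) ∈ Metric.ball a ε → z.2 ≠ 0 →
      HasDerivAt (fun t => φ (z.1, t)) (V (φ z)) z.2 := by
    rintro ⟨x, T⟩ h1 h2 hT
    simp only at h1 h2 hT ⊢
    obtain ⟨γ, hγ1, hγ2⟩ := hcurve _ h1 h2
    simp only at hγ1 hγ2
    have hcont : Continuous fun t => V (γ (Set.projIcc (0 : ℝ) 1 zero_le_one t)) :=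
      hV.continuous.comp (γ.continuous.comp continuous_projIcc)
    have hFTC := (hcont.integral_hasStrictDerivAt 0 (T / (2 * T))).hasDerivAt
    have hlin : HasDerivAt (fun t : ℝ => t / (2 * T)) (1 / (2 * T)) T :=
      (hasDerivAt_id T).div_const _
    have hcomp := ((hFTC.scomp T hlin).const_smul (2 * T)).const_add x
    have hhalf : T / (2 * T) = 1 / 2 := by field_simp
    have hmemI : ∀ᶠ t in 𝓝 T, t / (2 * T) ∈ Set.Icc (0 : ℝ) 1 := by
      have hc : ContinuousAt (fun t : ℝ => t / (2 * T)) T := by fun_prop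
      refine hc.eventually_mem ?_
      rw [hhalf]
      exact Icc_mem_nhds (by norm_num) (by norm_num)
    have hval : ∀ t, t / (2 * T) ∈ Set.Icc (0 : ℝ) 1 → φ (x, t) =
        γ (Set.projIcc 0 1 zero_le_one (t / (2 * T))) := by
      intro t ht
      rw [Set.projIcc_of_mem _ ht, ← hγ1]
      congr 2
      field_simp
    have hev : (fun t => φ (x, t)) =ᶠ[𝓝 T] fun t =>
        x + (2 * T) • ∫ t in (0 : ℝ)..(t / (2 * T)), V (γ (Set.projIcc 0 1 zero_le_one t)) := by
      filter_upwards [hmemI] with t ht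
      rw [hval t ht, hγ2, Set.projIcc_of_mem _ ht]
    refine (hcomp.congr_of_eventuallyEq hev).congr_deriv ?_
    rw [hval T hmemI.self_of_nhds, smul_smul]
    rw [mul_one_div_cancel (mul_ne_zero two_ne_zero hT), one_smul]
  refine ⟨φ, hgood.mono fun z hz => hsmooth z hz.1, ?_⟩
  have hc2 : ContinuousAt (fun z : E × ℝ => (z.1, 2 * z.2)) (x₀, 0) := by fun_prop
  have hgood2 : ∀ᶠ z in 𝓝 (x₀, (0 : ℝ)), ((z.1, 2 * z.2), (0 : C(I, E))) ∈ R.target ∧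
      R.symm ((z.1, 2 * z.2), 0) ∈ Metric.ball a ε := by
    have h : ∀ᶠ z in 𝓝 ((x₀, (0 : ℝ)).1, 2 * (x₀, (0 : ℝ)).2), (z, (0 : C(I, E))) ∈ R.target ∧
        R.symm (z, 0) ∈ Metric.ball a ε := by
      simpa using hgood
    exact hc2.eventually h
  filter_upwards [hgood, hgood2, hgood2.eventually_nhds] with z hz hz2 hz3
  refine ⟨hinit z hz.1 hz.2, ?_⟩
  -- At time zero the reparametrisation degenerates. There the time derivative of `φ` and `V ∘ φ`
  -- are both continuous in time and agree at small nonzero times, hence also at zero.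
  by_cases hT : z.2 = 0
  · obtain ⟨x, T⟩ := z
    simp only at hT
    subst hT
    have hsm := hsmooth _ hz.1
    have hD : ∀ᶠ t in 𝓝 (0 : ℝ), HasDerivAt (fun t => φ (x, t)) (fderiv ℝ φ (x, t) (0, 1)) t := by
      have hT : ∀ᶠ t in 𝓝 (0 : ℝ), ((x, t), (0 : C(I, E))) ∈ R.target := by
        have hc : Continuous fun t : ℝ => ((x, t), (0 : C(I, E))) := by fun_prop
        exact hc.continuousAt.eventually_mem (R.open_target.mem_nhds hz.1)
      filter_upwards [hT] with t ht
      have h1 := ((hsmooth _ ht).differentiableAt (by simp)).hasFDerivAt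
      exact h1.comp_hasDerivAt t ((hasDerivAt_const t x).prodMk (hasDerivAt_id t))
    have hDc : ContinuousAt (fun t : ℝ => fderiv ℝ φ (x, t) (0, 1)) 0 := by
      have h1 : ContinuousAt (fderiv ℝ φ) (x, 0) := hsm.continuousAt_fderiv (by simp)
      have h2 : ContinuousAt (fun t : ℝ => fderiv ℝ φ (x, t)) 0 :=
        ContinuousAt.comp (g := fderiv ℝ φ) (f := fun t : ℝ => (x, t)) h1 (by fun_prop)
      exact h2.clm_apply continuousAt_const
    have hVc : ContinuousAt (fun t : ℝ => V (φ (x, t))) 0 := by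
      have h2 : ContinuousAt (fun t : ℝ => φ (x, t)) 0 :=
        ContinuousAt.comp (g := φ) (f := fun t : ℝ => (x, t)) hsm.continuousAt (by fun_prop)
      exact ContinuousAt.comp (g := V) hV.continuous.continuousAt h2
    have heq : ∀ᶠ t in 𝓝[≠] (0 : ℝ), fderiv ℝ φ (x, t) (0, 1) = V (φ (x, t)) := by
      have hc : ContinuousAt (fun t : ℝ => (x, t)) 0 := by fun_prop
      have h3 := hc.eventually hz3
      filter_upwards [h3.filter_mono nhdsWithin_le_nhds, hD.filter_mono nhdsWithin_le_nhds,
        self_mem_nhdsWithin] with t ht1 ht2 ht3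
      exact ht2.unique (hderiv (x, t) ht1.1 ht1.2 ht3)
    have h0 : fderiv ℝ φ (x, 0) (0, 1) = V (φ (x, 0)) :=
      tendsto_nhds_unique_of_eventuallyEq (hDc.tendsto.mono_left nhdsWithin_le_nhds)
        (hVc.tendsto.mono_left nhdsWithin_le_nhds) heq
    rw [← h0]
    exact hD.self_of_nhds
  · exact hderiv z hz2.1 hz2.2 hT

end Flow

/-! ### Straightening a vector field -/

section FlowBox

variable {E : Type u} [NormedAddCommGroup E] [NormedSpace ℝ E] [FiniteDimensional ℝ E]

/-- Multiplication by a bump function. The superposition operator is defined for a field smooth on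
all of `E`, whereas coordinate expressions are smooth only near a point. -/
theorem exists_contDiff_eventuallyEq {V : E → E} {x₀ : E}
    (hV : ∀ᶠ x in 𝓝 x₀, ContDiffAt ℝ ∞ V x) :
    ∃ W : E → E, ContDiff ℝ ∞ W ∧ W =ᶠ[𝓝 x₀] V := by
  obtain ⟨r, hr, hball⟩ := Metric.eventually_nhds_iff_ball.1 hV
  let f : ContDiffBump x₀ := ⟨r / 3, r / 2, by positivity, by linarith⟩
  refine ⟨fun x => f x • V x, contDiff_iff_contDiffAt.2 fun x => ?_, ?_⟩
  · by_cases hx : x ∈ Metric.ball x₀ r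
    · exact f.contDiffAt.smul (hball x hx)
    · have hx' : x ∉ tsupport f := by
        rw [f.tsupport_eq]
        intro h
        exact hx (Metric.closedBall_subset_ball (by change r / 2 < r; linarith) h)
      have h0 : (fun x => f x • V x) =ᶠ[𝓝 x] fun _ => 0 := by
        filter_upwards [notMem_tsupport_iff_eventuallyEq.1 hx'] with y hy
        simp [hy]
      exact contDiffAt_const.congr_of_eventuallyEq h0
  · filter_upwards [f.eventuallyEq_one] with x hx
    simp [hx]

theorem exists_smooth_flow {V : E → E} {x₀ : E} (hV : ∀ᶠ x in 𝓝 x₀, ContDiffAt ℝ ∞ V x) :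
    ∃ φ : E × ℝ → E, (∀ᶠ z in 𝓝 (x₀, (0 : ℝ)), ContDiffAt ℝ ∞ φ z) ∧
      (∀ᶠ z in 𝓝 (x₀, (0 : ℝ)), φ (z.1, 0) = z.1 ∧
        HasDerivAt (fun t => φ (z.1, t)) (V (φ z)) z.2) := by
  obtain ⟨W, hW, hWV⟩ := exists_contDiff_eventuallyEq hV
  have : CompleteSpace E := FiniteDimensional.complete ℝ E
  obtain ⟨φ, h1, h2⟩ := exists_smooth_flow_of_contDiff hW x₀
  refine ⟨φ, h1, ?_⟩
  have h0 : φ (x₀, 0) = x₀ := h2.self_of_nhds.1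
  have hc : Tendsto φ (𝓝 (x₀, 0)) (𝓝 x₀) := by
    have := h1.self_of_nhds.continuousAt.tendsto
    rwa [h0] at this
  filter_upwards [h2, hc.eventually hWV] with z hz hz'
  exact ⟨hz.1, hz' ▸ hz.2⟩

/-- Straightening of a vector field which does not vanish at `x₀`, with prescribed differential of
the straightening map at `x₀`. -/
theorem exists_flowBox {V : E → E} {x₀ : E} (hV : ∀ᶠ x in 𝓝 x₀, ContDiffAt ℝ ∞ V x)
    (D : E ≃L[ℝ] E) (τ : E →L[ℝ] ℝ) {v : E} (hv : τ v = 1) (hD : D v = V x₀) :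
    ∃ g : E → E, (∀ᶠ x in 𝓝 x₀, ContDiffAt ℝ ∞ g x) ∧ g x₀ = 0 ∧
      HasFDerivAt g (D.symm : E →L[ℝ] E) x₀ ∧ ∀ᶠ x in 𝓝 x₀, fderiv ℝ g x (V x) = v := by
  have : CompleteSpace E := FiniteDimensional.complete ℝ E
  obtain ⟨φ, h1, h2⟩ := exists_smooth_flow hV
  -- The map to be inverted is `Ψ w = φ (x₀ + N w, τ w)`. Since `τ v = 1` and `D v = V x₀`, one has
  -- `N v = 0`: motion along `v` is pure flow time, so `Ψ` carries `v` to `V`. At the origin its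
  -- differential is `N + τ ⊗ V x₀ = D`.
  let N : E →L[ℝ] E := D - τ.smulRight (V x₀)
  let ι : E →L[ℝ] E × ℝ := N.prod τ
  let q : E → E × ℝ := fun w => (x₀, 0) + ι w
  have hq0 : q 0 = (x₀, 0) := by simp [q]
  have hq : ContDiff ℝ ∞ q := contDiff_const.add ι.contDiff
  have hq' : ∀ w, HasFDerivAt q ι w := fun w => ι.hasFDerivAt.const_add _
  have hqt : Tendsto q (𝓝 0) (𝓝 (x₀, 0)) := by
    have := hq.continuous.tendsto 0
    rwa [hq0] at this
  have hιv : ι v = (0, 1) := by simp [ι, N, hv, hD]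
  let Ψ : E → E := fun w => φ (q w)
  have hΨ : ∀ᶠ w in 𝓝 0, ContDiffAt ℝ ∞ Ψ w :=
    (hqt.eventually h1).mono fun w hw => hw.comp w hq.contDiffAt
  have hΨ0 : Ψ 0 = x₀ := by
    change φ (q 0) = x₀
    rw [hq0]
    exact h2.self_of_nhds.1
  have hΨv : ∀ᶠ w in 𝓝 0, fderiv ℝ Ψ w v = V (Ψ w) := by
    filter_upwards [hqt.eventually h1, hqt.eventually h2] with w hw1 hw2
    have ha := (hw1.differentiableAt (by simp)).hasFDerivAt
    have hb : HasDerivAt (fun t => φ ((q w).1, t)) (fderiv ℝ φ (q w) (0, 1)) (q w).2 :=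
      ha.comp_hasDerivAt (q w).2 ((hasDerivAt_const _ (q w).1).prodMk (hasDerivAt_id _))
    have hf : fderiv ℝ Ψ w = fderiv ℝ φ (q w) ∘L ι := (ha.comp w (hq' w)).fderiv
    rw [hf, ContinuousLinearMap.comp_apply, hιv]
    exact hb.unique hw2.2
  have hΨ' : HasFDerivAt Ψ (D : E →L[ℝ] E) 0 := by
    have ha := (h1.self_of_nhds.differentiableAt (by simp)).hasFDerivAt
    have hc : HasFDerivAt (fun x => φ (x, 0))
        (fderiv ℝ φ (x₀, 0) ∘L ContinuousLinearMap.inl ℝ E ℝ) x₀ :=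
      HasFDerivAt.comp (g := φ) x₀ ha (hasFDerivAt_prodMk_left x₀ 0)
    have hid : (fun x => φ (x, 0)) =ᶠ[𝓝 x₀] id := by
      have ht : Tendsto (fun x : E => (x, (0 : ℝ))) (𝓝 x₀) (𝓝 (x₀, 0)) :=
        Continuous.tendsto (by fun_prop) x₀
      exact (ht.eventually h2).mono fun x hx => hx.1
    have he := hc.unique ((hasFDerivAt_id x₀).congr_of_eventuallyEq hid)
    have hd := hΨ.self_of_nhds.differentiableAt (by simp) |>.hasFDerivAt
    convert! hd using 1
    have hv0 := hΨv.self_of_nhds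
    rw [hΨ0] at hv0
    have hf : fderiv ℝ Ψ 0 = fderiv ℝ φ (x₀, 0) ∘L ι := by
      have ha' : HasFDerivAt φ (fderiv ℝ φ (x₀, 0)) (q 0) := by rw [hq0]; exact ha
      exact (ha'.comp 0 (hq' 0)).fderiv
    ext w
    rw [hf] at hv0 ⊢
    rw [ContinuousLinearMap.comp_apply, hιv] at hv0
    have hsplit : ι w = ContinuousLinearMap.inl ℝ E ℝ (N w) + τ w • ((0 : E), (1 : ℝ)) := by
      simp [ι]
    have he' := congrArg (fun A : E →L[ℝ] E => A (N w)) he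
    simp only [ContinuousLinearMap.comp_apply, ContinuousLinearMap.id_apply] at he'
    rw [ContinuousLinearMap.comp_apply, hsplit, map_add, map_smul, hv0, he']
    simp [N]
  obtain ⟨R, h0R, hRΨ, hRs, hRsymm⟩ := exists_openPartialHomeomorph_of_hasFDerivAt hΨ hΨ'
  have hxR : x₀ ∈ R.target := by
    rw [← hΨ0, ← hRΨ]; exact R.map_source h0R
  have hsx : R.symm x₀ = 0 := by
    rw [← hΨ0, ← hRΨ, R.left_inv h0R]
  refine ⟨R.symm, ?_, hsx, ?_, ?_⟩
  · filter_upwards [R.open_target.mem_nhds hxR] with y hy using hRsymm y hy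
  · refine R.hasFDerivAt_symm hxR ?_
    rw [hsx, hRΨ]
    exact hΨ'
  · have hct := R.continuousAt_symm hxR
    rw [ContinuousAt, hsx] at hct
    filter_upwards [R.open_target.mem_nhds hxR, hct.eventually hΨv] with y hy hy2
    have hs := R.map_target hy
    have ha := ((hRs _ hs).differentiableAt (by simp)).hasFDerivAt
    have hR : Ψ (R.symm y) = y := by rw [← hRΨ]; exact R.right_inv hy
    have hb : HasFDerivAt R.symm (fderiv ℝ R.symm y) (Ψ (R.symm y)) := by
      rw [hR]
      exact ((hRsymm y hy).differentiableAt (by simp)).hasFDerivAt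
    have hc := hb.comp (R.symm y) ha
    have hid : (R.symm ∘ Ψ) =ᶠ[𝓝 (R.symm y)] id := by
      filter_upwards [R.open_source.mem_nhds hs] with z hz
      rw [← hRΨ]
      exact R.left_inv hz
    have he := hc.unique ((hasFDerivAt_id _).congr_of_eventuallyEq hid)
    have he' := congrArg (fun A : E →L[ℝ] E => A v) he
    simp only [ContinuousLinearMap.comp_apply, ContinuousLinearMap.id_apply, hy2, hR] at he'
    exact he'

end FlowBox

/-! ### Calculus in a chart -/

section Charts

variable {M : Type*} [TopologicalSpace M] [ChartedSpace E3 M] [IsManifold (𝓡 3) ∞ M]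
  {e : OpenPartialHomeomorph M E3} {x : M}

theorem contMDiffAt_chart (he : e ∈ IsManifold.maximalAtlas (𝓡 3) ∞ M) (hx : x ∈ e.source) :
    ContMDiffAt (𝓡 3) (𝓡 3) ∞ e x :=
  contMDiffAt_of_mem_maximalAtlas he hx

theorem contMDiffAt_chart_symm (he : e ∈ IsManifold.maximalAtlas (𝓡 3) ∞ M) {u : E3}
    (hu : u ∈ e.target) : ContMDiffAt (𝓡 3) (𝓡 3) ∞ e.symm u :=
  contMDiffAt_symm_of_mem_maximalAtlas he hu

theorem mdifferentiable_chart_of_mem (he : e ∈ IsManifold.maximalAtlas (𝓡 3) ∞ M) :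
    e.MDifferentiable (𝓡 3) (𝓡 3) :=
  ⟨fun _ hx => ((contMDiffAt_chart he hx).mdifferentiableAt (by simp)).mdifferentiableWithinAt,
    fun _ hu => ((contMDiffAt_chart_symm he hu).mdifferentiableAt
      (by simp)).mdifferentiableWithinAt⟩

/-- The differential of a chart at a point of its domain. -/
def chartEquiv (he : e ∈ IsManifold.maximalAtlas (𝓡 3) ∞ M) (hx : x ∈ e.source) :
    TangentSpace (𝓡 3) x ≃L[ℝ] E3 :=
  (mdifferentiable_chart_of_mem he).mfderiv hx

theorem chartEquiv_coe (he : e ∈ IsManifold.maximalAtlas (𝓡 3) ∞ M) (hx : x ∈ e.source) :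
    (chartEquiv he hx : TangentSpace (𝓡 3) x →L[ℝ] E3) = mfderiv (𝓡 3) (𝓡 3) e x := rfl

theorem coordVec_eq (he : e ∈ IsManifold.maximalAtlas (𝓡 3) ∞ M) (hx : x ∈ e.source)
    (i : Fin 3) :
    coordVec e i x = (chartEquiv he hx).symm (EuclideanSpace.single i (1 : ℝ)) := by
  unfold coordVec
  rw [← chartEquiv_coe he hx]
  exact congrArg (fun A : E3 →L[ℝ] TangentSpace (𝓡 3) x => A (EuclideanSpace.single i (1 : ℝ)))
    (ContinuousLinearMap.inverse_equiv (chartEquiv he hx))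

theorem coordCovec_eq (he : e ∈ IsManifold.maximalAtlas (𝓡 3) ∞ M) (hx : x ∈ e.source)
    (j : Fin 3) (v : TangentSpace (𝓡 3) x) :
    coordCovec e j x v = chartEquiv he hx v j := by
  have h1 : HasMFDerivAt (𝓡 3) 𝓘(ℝ, ℝ) (fun u : E3 => u j) (e x)
      (EuclideanSpace.proj j : E3 →L[ℝ] ℝ) :=
    (EuclideanSpace.proj (𝕜 := ℝ) j).hasFDerivAt.hasMFDerivAt
  have h2 := ((contMDiffAt_chart he hx).mdifferentiableAt (by simp)).hasMFDerivAt
  have h3 := h1.comp x h2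
  unfold coordCovec
  have h4 : mfderiv (𝓡 3) 𝓘(ℝ, ℝ) (fun y => e y j) x = _ := h3.mfderiv
  rw [h4]
  rfl

theorem coordCovec_coordVec (he : e ∈ IsManifold.maximalAtlas (𝓡 3) ∞ M) (hx : x ∈ e.source)
    (i j : Fin 3) : coordCovec e j x (coordVec e i x) = if j = i then 1 else 0 := by
  rw [coordCovec_eq he hx, coordVec_eq he hx, ContinuousLinearEquiv.apply_symm_apply]
  simp

theorem sum_coordCovec_smul_coordVec (he : e ∈ IsManifold.maximalAtlas (𝓡 3) ∞ M)
    (hx : x ∈ e.source) (v : TangentSpace (𝓡 3) x) :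
    ∑ j, coordCovec e j x v • coordVec e j x = v := by
  apply (chartEquiv he hx).injective
  rw [map_sum]
  ext k
  simp only [map_smul, coordVec_eq he hx, coordCovec_eq he hx,
    ContinuousLinearEquiv.apply_symm_apply]
  simp [Fin.sum_univ_three]
  fin_cases k <;> simp

theorem tangent_ext (he : e ∈ IsManifold.maximalAtlas (𝓡 3) ∞ M) (hx : x ∈ e.source)
    {v w : TangentSpace (𝓡 3) x} (h : ∀ j, coordCovec e j x v = coordCovec e j x w) : v = w := by
  rw [← sum_coordCovec_smul_coordVec he hx v, ← sum_coordCovec_smul_coordVec he hx w]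
  simp_rw [h]

/-- The coordinate vector fields as a basis of the tangent space. -/
def coordBasis (he : e ∈ IsManifold.maximalAtlas (𝓡 3) ∞ M) (hx : x ∈ e.source) :
    Module.Basis (Fin 3) ℝ (TangentSpace (𝓡 3) x) :=
  (EuclideanSpace.basisFun (Fin 3) ℝ).toBasis.map (chartEquiv he hx).symm.toLinearEquiv

theorem coordBasis_apply (he : e ∈ IsManifold.maximalAtlas (𝓡 3) ∞ M) (hx : x ∈ e.source)
    (i : Fin 3) : coordBasis he hx i = coordVec e i x := by
  rw [coordVec_eq he hx]
  simp [coordBasis]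

theorem coordBasis_repr (he : e ∈ IsManifold.maximalAtlas (𝓡 3) ∞ M) (hx : x ∈ e.source)
    (v : TangentSpace (𝓡 3) x) (i : Fin 3) :
    (coordBasis he hx).repr v i = coordCovec e i x v := by
  rw [coordCovec_eq he hx]
  simp [coordBasis]

/-! Smoothness of components -/

/-- A vector field is smooth at a point. -/
abbrev SmoothVFieldAt (X : VField M) (x : M) : Prop :=
  ContMDiffAt (𝓡 3) (𝓡 3).tangent ∞ (fun x => (⟨x, X x⟩ : TangentBundle (𝓡 3) M)) x

theorem smoothVFieldAt_coordVec (he : e ∈ IsManifold.maximalAtlas (𝓡 3) ∞ M) (hx : x ∈ e.source)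
    (i : Fin 3) : SmoothVFieldAt (coordVec e i) x := by
  have hV : ContMDiffAt (𝓡 3) (𝓡 3).tangent ∞
      (fun u : E3 => (⟨u, (EuclideanSpace.single i (1 : ℝ) : E3)⟩ : TangentBundle (𝓡 3) E3))
      (e x) := contMDiffAt_vectorSpace_iff_contDiffAt.2 contDiffAt_const
  have h2 := ContMDiffAt.mpullback_vectorField_preimage (n := ∞) (m := ∞) hV
    (contMDiffAt_chart he hx) ⟨chartEquiv he hx, rfl⟩ (by simp)
  exact h2

/-- The coordinate expression of a vector field. -/
def coordExpr (e : OpenPartialHomeomorph M E3) (X : VField M) : E3 → E3 :=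
  VectorField.mpullback (𝓡 3) (𝓡 3) e.symm X

theorem coordExpr_apply (he : e ∈ IsManifold.maximalAtlas (𝓡 3) ∞ M) (hx : x ∈ e.source)
    (X : VField M) : coordExpr e X (e x) = chartEquiv he hx (X x) := by
  have hd := mdifferentiable_chart_of_mem he
  let A := hd.symm.mfderiv (e.map_source hx)
  have h1 : (mfderiv (𝓡 3) (𝓡 3) e.symm (e x)).inverse = A.symm :=
    ContinuousLinearMap.inverse_equiv A
  have h2 : ∀ w, mfderiv (𝓡 3) (𝓡 3) e (e.symm (e x)) (A w) = w := fun w =>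
    congrArg (fun B => B w) (hd.comp_symm_deriv (e.map_source hx))
  have h3 : e.symm (e x) = x := e.left_inv hx
  unfold coordExpr
  rw [VectorField.mpullback_apply, h1]
  have h4 := h2 (A.symm (X (e.symm (e x))))
  rw [A.apply_symm_apply] at h4
  refine h4.symm.trans ?_
  rw [h3]
  rfl

theorem contDiffAt_coordExpr (he : e ∈ IsManifold.maximalAtlas (𝓡 3) ∞ M) (hx : x ∈ e.source)
    {X : VField M} (hX : SmoothVFieldAt X x) : ContDiffAt ℝ ∞ (coordExpr e X) (e x) := by
  have hd := mdifferentiable_chart_of_mem he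
  have hX' : SmoothVFieldAt X (e.symm (e x)) := by rwa [e.left_inv hx]
  have h2 := ContMDiffAt.mpullback_vectorField_preimage (n := ∞) (m := ∞) hX'
    (contMDiffAt_chart_symm he (e.map_source hx))
    ⟨hd.symm.mfderiv (e.map_source hx), rfl⟩ (by simp)
  exact contMDiffAt_vectorSpace_iff_contDiffAt.1 h2

theorem contMDiffAt_coordCovec (he : e ∈ IsManifold.maximalAtlas (𝓡 3) ∞ M) (hx : x ∈ e.source)
    {X : VField M} (hX : SmoothVFieldAt X x) (j : Fin 3) :
    ContMDiffAt (𝓡 3) 𝓘(ℝ, ℝ) ∞ (fun y => coordCovec e j y (X y)) x := by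
  have h1 : ContDiffAt ℝ ∞ (fun u => coordExpr e X u j) (e x) :=
    (EuclideanSpace.proj j : E3 →L[ℝ] ℝ).contDiff.contDiffAt.comp _
      (contDiffAt_coordExpr he hx hX)
  have h2 := h1.contMDiffAt.comp x (contMDiffAt_chart he hx)
  refine h2.congr_of_eventuallyEq ?_
  filter_upwards [e.open_source.mem_nhds hx] with y hy
  rw [coordCovec_eq he hy, Function.comp_apply, coordExpr_apply he hy]

/-- The components of the Lie bracket in a chart. -/
theorem coordCovec_mlieBracket (he : e ∈ IsManifold.maximalAtlas (𝓡 3) ∞ M) (hx : x ∈ e.source)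
    {X Y : VField M} (hX : SmoothVFieldAt X x) (hY : SmoothVFieldAt Y x) (j : Fin 3) :
    coordCovec e j x (VectorField.mlieBracket (𝓡 3) X Y x) =
      ∑ i, (coordCovec e i x (X x) * pderiv e i (fun y => coordCovec e j y (Y y)) x -
        coordCovec e i x (Y x) * pderiv e i (fun y => coordCovec e j y (X y)) x) := by
  have key : ∀ {Z W : VField M}, SmoothVFieldAt W x →
      (fderiv ℝ (coordExpr e W) (e x) (coordExpr e Z (e x))) j =
        ∑ i, coordCovec e i x (Z x) * pderiv e i (fun y => coordCovec e j y (W y)) x := by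
    intro Z W hW
    have hd := (contDiffAt_coordExpr he hx hW).differentiableAt (by simp)
    have hp : HasFDerivAt (fun u => coordExpr e W u j)
        ((EuclideanSpace.proj j : E3 →L[ℝ] ℝ) ∘L
          fderiv ℝ (coordExpr e W) (e x)) (e x) :=
      (EuclideanSpace.proj j : E3 →L[ℝ] ℝ).hasFDerivAt.comp _
        hd.hasFDerivAt
    have hpd : ∀ i, pderiv e i (fun y => coordCovec e j y (W y)) x =
        (fderiv ℝ (coordExpr e W) (e x) (EuclideanSpace.single i (1 : ℝ))) j := by
      intro i
      have heq : (fun u => coordCovec e j (e.symm u) (W (e.symm u))) =ᶠ[𝓝 (e x)]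
          fun u => coordExpr e W u j := by
        filter_upwards [e.open_target.mem_nhds (e.map_source hx)] with u hu
        have hs := e.map_target hu
        rw [coordCovec_eq he hs, ← coordExpr_apply he hs, e.right_inv hu]
      unfold pderiv
      rw [heq.fderiv_eq, hp.fderiv]
      rfl
    simp_rw [hpd]
    have hz : coordExpr e Z (e x) =
        ∑ i, coordCovec e i x (Z x) • (EuclideanSpace.single i (1 : ℝ) : E3) := by
      ext k
      rw [coordExpr_apply he hx]
      simp_rw [coordCovec_eq he hx]
      fin_cases k <;> simp [Fin.sum_univ_three]
    rw [hz, map_sum]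
    simp [Fin.sum_univ_three]
  have hd := mdifferentiable_chart_of_mem he
  have hxs : e.symm (e x) = x := e.left_inv hx
  have h2 : (2 : WithTop ℕ∞) ≤ ∞ := ENat.LEInfty.out
  have hman : IsManifold (𝓡 3) (minSmoothness ℝ 2) M := by
    rw [minSmoothness_of_isRCLikeNormedField]
    exact IsManifold.of_le h2
  have hb := VectorField.mpullback_mlieBracket (I := 𝓡 3) (I' := 𝓡 3) (f := e.symm) (x₀ := e x)
    (V := X) (W := Y) (n := ∞)
    (by rw [hxs]; exact hX.mdifferentiableAt (by simp))
    (by rw [hxs]; exact hY.mdifferentiableAt (by simp))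
    (contMDiffAt_chart_symm he (e.map_source hx)) (by simpa using h2)
  have h1 : coordExpr e (VectorField.mlieBracket (𝓡 3) X Y) (e x) =
      VectorField.lieBracket ℝ (coordExpr e X) (coordExpr e Y) (e x) := by
    refine hb.trans ?_
    rw [← VectorField.mlieBracketWithin_univ, ← VectorField.lieBracketWithin_univ]
    exact congrFun VectorField.mlieBracketWithin_eq_lieBracketWithin _
  rw [coordCovec_eq he hx, ← coordExpr_apply he hx, h1, VectorField.lieBracket,
    Finset.sum_sub_distrib, ← key hY, ← key hX]
  rfl

end Charts

/-! ### Partial derivatives, smooth fields and changes of chart -/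

section Charts

variable {M : Type*} [TopologicalSpace M] [ChartedSpace E3 M] [IsManifold (𝓡 3) ∞ M]
  {e : OpenPartialHomeomorph M E3} {x : M}

/-- A real-valued function is smooth at a point. -/
abbrev SmoothAt (f : M → ℝ) (x : M) : Prop := ContMDiffAt (𝓡 3) 𝓘(ℝ, ℝ) ∞ f x

theorem SmoothAt.contDiffAt {f : M → ℝ} (hf : SmoothAt f x)
    (he : e ∈ IsManifold.maximalAtlas (𝓡 3) ∞ M) (hx : x ∈ e.source) :
    ContDiffAt ℝ ∞ (fun u => f (e.symm u)) (e x) := by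
  have hf' : SmoothAt f (e.symm (e x)) := by rwa [e.left_inv hx]
  exact (hf'.comp (e x) (contMDiffAt_chart_symm he (e.map_source hx))).contDiffAt

theorem SmoothAt.differentiableAt {f : M → ℝ} (hf : SmoothAt f x)
    (he : e ∈ IsManifold.maximalAtlas (𝓡 3) ∞ M) (hx : x ∈ e.source) :
    DifferentiableAt ℝ (fun u => f (e.symm u)) (e x) :=
  (hf.contDiffAt he hx).differentiableAt (by simp)

theorem SmoothAt.mul {f g : M → ℝ} (hf : SmoothAt f x) (hg : SmoothAt g x) :
    SmoothAt (fun y => f y * g y) x :=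
  contDiff_mul.contDiffAt.contMDiffAt.comp x (hf.prodMk_space hg)

theorem SmoothAt.div {f g : M → ℝ} (hf : SmoothAt f x) (hg : SmoothAt g x) (h0 : g x ≠ 0) :
    SmoothAt (fun y => f y / g y) x :=
  ContMDiffAt.comp (g := fun q : ℝ × ℝ => q.1 / q.2) x
    (contDiffAt_fst.div contDiffAt_snd h0).contMDiffAt (hf.prodMk_space hg)

theorem smoothAt_const (c : ℝ) : SmoothAt (fun _ : M => c) x := contMDiffAt_const

theorem pderiv_congr (hx : x ∈ e.source) {f g : M → ℝ} (h : f =ᶠ[𝓝 x] g) (i : Fin 3) :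
    pderiv e i f x = pderiv e i g x := by
  unfold pderiv
  have ht : Tendsto e.symm (𝓝 (e x)) (𝓝 x) := by
    have := e.continuousAt_symm (e.map_source hx)
    rwa [ContinuousAt, e.left_inv hx] at this
  have h2 : (fun u => f (e.symm u)) =ᶠ[𝓝 (e x)] fun u => g (e.symm u) := ht.eventually h
  rw [h2.fderiv_eq]

theorem pderiv_sum (he : e ∈ IsManifold.maximalAtlas (𝓡 3) ∞ M) (hx : x ∈ e.source)
    {f : Fin 3 → M → ℝ} (hf : ∀ j, SmoothAt (f j) x) (i : Fin 3) :
    pderiv e i (fun y => ∑ j, f j y) x = ∑ j, pderiv e i (f j) x := by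
  unfold pderiv
  rw [fderiv_fun_sum fun j _ => (hf j).differentiableAt he hx]
  simp

theorem pderiv_neg {f : M → ℝ} (i : Fin 3) :
    pderiv e i (fun y => -f y) x = -pderiv e i f x := by
  unfold pderiv
  rw [fderiv_fun_neg]
  rfl

theorem pderiv_const (c : ℝ) (i : Fin 3) : pderiv e i (fun _ : M => c) x = 0 := by
  simp [pderiv]

theorem pderiv_mul (he : e ∈ IsManifold.maximalAtlas (𝓡 3) ∞ M) (hx : x ∈ e.source)
    {f g : M → ℝ} (hf : SmoothAt f x) (hg : SmoothAt g x) (i : Fin 3) :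
    pderiv e i (fun y => f y * g y) x = pderiv e i f x * g x + f x * pderiv e i g x := by
  unfold pderiv
  rw [fderiv_fun_mul (hf.differentiableAt he hx) (hg.differentiableAt he hx)]
  simp [e.left_inv hx]
  ring

/-- The derivative of a function along a tangent vector, in a chart. -/
theorem sum_coordCovec_mul_pderiv (he : e ∈ IsManifold.maximalAtlas (𝓡 3) ∞ M)
    (hx : x ∈ e.source) {f : M → ℝ} (hf : SmoothAt f x) (v : TangentSpace (𝓡 3) x) :
    ∑ i, coordCovec e i x v * pderiv e i f x = mfderiv (𝓡 3) 𝓘(ℝ, ℝ) f x v := by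
  have h1 : HasMFDerivAt (𝓡 3) 𝓘(ℝ, ℝ) (fun u : E3 => f (e.symm u)) (e x)
      (fderiv ℝ (fun u => f (e.symm u)) (e x)) :=
    (hf.differentiableAt he hx).hasFDerivAt.hasMFDerivAt
  have h2 := ((contMDiffAt_chart he hx).mdifferentiableAt (by simp)).hasMFDerivAt
  have h3 := h1.comp x h2
  have h4 : f =ᶠ[𝓝 x] (fun u : E3 => f (e.symm u)) ∘ e := by
    filter_upwards [e.open_source.mem_nhds hx] with y hy
    simp [e.left_inv hy]
  have h5 := (h3.congr_of_eventuallyEq h4).mfderiv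
  rw [h5]
  change _ = fderiv ℝ (fun u => f (e.symm u)) (e x) (chartEquiv he hx v)
  have h6 : chartEquiv he hx v =
      ∑ i, coordCovec e i x v • (EuclideanSpace.single i (1 : ℝ) : E3) := by
    ext k
    simp_rw [coordCovec_eq he hx]
    fin_cases k <;> simp [Fin.sum_univ_three]
  rw [h6, map_sum]
  simp only [map_smul, smul_eq_mul]
  rfl

theorem smoothVFieldAt_end_apply {K : EndField M} (hK : SmoothEndField K) {X : VField M}
    (hX : SmoothVFieldAt X x) : SmoothVFieldAt (fun y => K y (X y)) x :=
  (hK x).clm_bundle_apply hX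

theorem smoothAt_inner (h : Metric M) {X Y : VField M} (hX : SmoothVFieldAt X x)
    (hY : SmoothVFieldAt Y x) : SmoothAt (fun y => h.inner y (X y) (Y y)) x := by
  have h1 := ContMDiffAt.clm_bundle_apply₂ (E₃ := Bundle.Trivial M ℝ) (F₃ := ℝ) (b := id)
    (h.contMDiff x) hX hY
  simp only [Bundle.contMDiffAt_totalSpace] at h1
  exact h1.2

theorem SmoothVFieldAt.smul {f : M → ℝ} {X : VField M} (hf : SmoothAt f x)
    (hX : SmoothVFieldAt X x) : SmoothVFieldAt (fun y => f y • X y) x :=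
  hf.smul_section hX

theorem SmoothVFieldAt.add {X Y : VField M} (hX : SmoothVFieldAt X x)
    (hY : SmoothVFieldAt Y x) : SmoothVFieldAt (fun y => X y + Y y) x :=
  hX.add_section hY

theorem smoothAt_endComp {K : EndField M} (hK : SmoothEndField K)
    (he : e ∈ IsManifold.maximalAtlas (𝓡 3) ∞ M) (hx : x ∈ e.source) (i j : Fin 3) :
    SmoothAt (endComp e K i j) x :=
  contMDiffAt_coordCovec he hx (smoothVFieldAt_end_apply hK (smoothVFieldAt_coordVec he hx i)) j

theorem smoothAt_metricMatrix (h : Metric M)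
    (he : e ∈ IsManifold.maximalAtlas (𝓡 3) ∞ M) (hx : x ∈ e.source) (i j : Fin 3) :
    SmoothAt (fun y => metricMatrix e h y i j) x :=
  smoothAt_inner h (smoothVFieldAt_coordVec he hx i) (smoothVFieldAt_coordVec he hx j)

/-- Composing a chart with a local diffeomorphism of the model space gives a chart. -/
theorem exists_chart_comp (he : e ∈ IsManifold.maximalAtlas (𝓡 3) ∞ M) (hx : x ∈ e.source)
    {g : E3 → E3} (hg : ∀ᶠ u in 𝓝 (e x), ContDiffAt ℝ ∞ g u) {g' : E3 ≃L[ℝ] E3}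
    (hg' : HasFDerivAt g (g' : E3 →L[ℝ] E3) (e x)) {U : Set M} (hU : U ∈ 𝓝 x) :
    ∃ e' ∈ IsManifold.maximalAtlas (𝓡 3) ∞ M, x ∈ e'.source ∧ e'.source ⊆ e.source ∩ U ∧
      ∀ y ∈ e'.source, e' y = g (e y) ∧ ∀ (hy : y ∈ e.source) (v : TangentSpace (𝓡 3) y) (j : Fin 3),
        coordCovec e' j y v = fderiv ℝ g (e y) (chartEquiv he hy v) j := by
  obtain ⟨R, hxR, hRg, hRs, hRt⟩ := exists_openPartialHomeomorph_of_hasFDerivAt hg hg'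
  obtain ⟨W, hWU, hWo, hxW⟩ := mem_nhds_iff.1 hU
  set e' : OpenPartialHomeomorph M E3 := (e.trans R).restrOpen W hWo with he'
  have hsrc : ∀ y ∈ e'.source, y ∈ e.source ∧ e y ∈ R.source ∧ y ∈ W := by
    intro y hy
    have h1 : y ∈ (e.source ∩ e ⁻¹' R.source) ∩ W := by simpa [he'] using hy
    exact ⟨h1.1.1, h1.1.2, h1.2⟩
  have hcoe : ∀ y, e' y = g (e y) := by
    intro y
    rw [← hRg]
    rfl
  have hatlas : e' ∈ IsManifold.maximalAtlas (𝓡 3) ∞ M := by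
    refine e'.mem_maximalAtlas_of_contMDiffOn ?_ ?_
    · intro y hy
      obtain ⟨h1, h2, -⟩ := hsrc y hy
      have h3 : ContMDiffAt (𝓡 3) (𝓡 3) ∞ (fun y => g (e y)) y :=
        (hRs _ h2).contMDiffAt.comp y (contMDiffAt_chart he h1)
      exact (h3.congr_of_eventuallyEq (Eventually.of_forall hcoe)).contMDiffWithinAt
    · intro u hu
      have hu' := hsrc _ (e'.map_target hu)
      have ht : u ∈ R.target ∧ R.symm u ∈ e.target := by
        have h1 : u ∈ (e.trans R).target := by
          have := e'.right_inv hu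
          rw [← this]
          exact (e.trans R).map_source (show e'.symm u ∈ (e.trans R).source by
            rw [OpenPartialHomeomorph.trans_source]; exact ⟨hu'.1, hu'.2.1⟩)
        simpa [OpenPartialHomeomorph.trans_target] using h1
      have h3 : ContMDiffAt (𝓡 3) (𝓡 3) ∞ (fun u => e.symm (R.symm u)) u :=
        (contMDiffAt_chart_symm he ht.2).comp u (hRt u ht.1).contMDiffAt
      exact h3.contMDiffWithinAt
  refine ⟨e', hatlas, ?_, fun y hy => ⟨(hsrc y hy).1, hWU (hsrc y hy).2.2⟩,
    fun y hy => ⟨hcoe y, fun hy' v j => ?_⟩⟩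
  · have : x ∈ (e.source ∩ e ⁻¹' R.source) ∩ W := ⟨⟨hx, hxR⟩, hxW⟩
    simpa [he'] using this
  · rw [coordCovec_eq hatlas hy]
    obtain ⟨h1, h2, -⟩ := hsrc y hy
    have h3 : HasMFDerivAt (𝓡 3) (𝓡 3) g (e y) (fderiv ℝ g (e y)) :=
      ((hRs _ h2).differentiableAt (by simp)).hasFDerivAt.hasMFDerivAt
    have h4 := ((contMDiffAt_chart he h1).mdifferentiableAt (by simp)).hasMFDerivAt
    have h5 := h3.comp y h4
    have h6 := (h5.congr_of_eventuallyEq (f₁ := e') (Eventually.of_forall hcoe)).mfderiv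
    have h7 : chartEquiv hatlas hy v = mfderiv (𝓡 3) (𝓡 3) e' y v := rfl
    rw [h7, h6]
    rfl

end Charts

/-! ### Algebra of the divergence in an orthogonal eigenframe -/

section Algebra

/-- Interchanging `i` and `m` matches the first term with the third, so against a symmetric `A` they
cancel. It is applied both to the inverse metric and to K with a raised index. -/
theorem sum_symm_mul_christoffel {A : Fin 3 → Fin 3 → ℝ} {dH : Fin 3 → Fin 3 → Fin 3 → ℝ}
    (hA : ∀ i m, A i m = A m i) (hH : ∀ l i m, dH l i m = dH l m i) (j : Fin 3) :
    ∑ i, ∑ m, A i m * (dH i j m + dH j i m - dH m i j) = ∑ i, ∑ m, A i m * dH j i m := by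
  have h1 : ∑ i, ∑ m, A i m * dH i j m = ∑ i, ∑ m, A i m * dH m i j := by
    rw [Finset.sum_comm]
    refine Finset.sum_congr rfl fun i _ => Finset.sum_congr rfl fun m _ => ?_
    rw [hA m i, hH m j i]
  simp only [mul_add, mul_sub, Finset.sum_add_distrib, Finset.sum_sub_distrib, h1]
  ring

/-- The divergence written with an orthogonal frame `P` of eigenvectors. -/
theorem divergence_eq_of_eigenframe {dK dH : Fin 3 → Fin 3 → Fin 3 → ℝ}
    {K G P : Fin 3 → Fin 3 → ℝ} {p q : Fin 3 → ℝ}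
    (hH : ∀ l i m, dH l i m = dH l m i)
    (hG : ∀ k m, G k m = ∑ B, q B * P B k * P B m)
    (hK : ∀ B i, ∑ k, P B k * K k i = p B * P B i) (j : Fin 3) :
    ∑ i, (dK i j i + ∑ k, (1 / 2 * ∑ m, G i m * (dH i k m + dH k i m - dH m i k)) * K j k
      - ∑ k, (1 / 2 * ∑ m, G k m * (dH i j m + dH j i m - dH m i j)) * K k i) =
    ∑ l, dK l j l + 1 / 2 * ∑ l, K j l * ∑ B, q B * ∑ k, ∑ m, P B k * P B m * dH l k m
      - 1 / 2 * ∑ B, p B * (q B * ∑ k, ∑ m, P B k * P B m * dH j k m) := by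
  have hGs : ∀ i m, G i m = G m i := fun i m => by
    rw [hG, hG]
    exact Finset.sum_congr rfl fun B _ => by ring
  have hfold : ∀ l, ∑ i, ∑ m, G i m * dH l i m =
      ∑ B, q B * ∑ k, ∑ m, P B k * P B m * dH l k m := by
    intro l
    simp only [hG, Fin.sum_univ_three]
    ring
  have h1 : ∑ i, ∑ k, (1 / 2 * ∑ m, G i m * (dH i k m + dH k i m - dH m i k)) * K j k =
      1 / 2 * ∑ l, K j l * ∑ B, q B * ∑ k, ∑ m, P B k * P B m * dH l k m := by
    rw [Finset.sum_comm, Finset.mul_sum]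
    refine Finset.sum_congr rfl fun k _ => ?_
    rw [← hfold, ← sum_symm_mul_christoffel hGs hH k, ← Finset.sum_mul, ← Finset.mul_sum]
    ring
  -- K with its index raised. The eigenvector equations diagonalise it in the frame, which shows its
  -- symmetry.
  let A : Fin 3 → Fin 3 → ℝ := fun i m => ∑ k, G k m * K k i
  have hA : ∀ i m, A i m = ∑ B, p B * q B * P B i * P B m := by
    intro i m
    have h0 := hK 0 i
    have h1 := hK 1 i
    have h2 := hK 2 i
    simp only [A, hG, Fin.sum_univ_three] at h0 h1 h2 ⊢
    linear_combination q 0 * P 0 m * h0 + q 1 * P 1 m * h1 + q 2 * P 2 m * h2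
  have hAs : ∀ i m, A i m = A m i := fun i m => by
    rw [hA, hA]
    exact Finset.sum_congr rfl fun B _ => by ring
  have h2 : ∑ i, ∑ k, (1 / 2 * ∑ m, G k m * (dH i j m + dH j i m - dH m i j)) * K k i =
      1 / 2 * ∑ B, p B * (q B * ∑ k, ∑ m, P B k * P B m * dH j k m) := by
    have h3 : ∑ i, ∑ k, (1 / 2 * ∑ m, G k m * (dH i j m + dH j i m - dH m i j)) * K k i =
        1 / 2 * ∑ i, ∑ m, A i m * (dH i j m + dH j i m - dH m i j) := by
      rw [Finset.mul_sum]
      refine Finset.sum_congr rfl fun i _ => ?_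
      simp only [A, Fin.sum_univ_three]
      ring
    rw [h3, sum_symm_mul_christoffel hAs hH j]
    simp only [hA, Fin.sum_univ_three]
    ring
  rw [Finset.sum_sub_distrib, Finset.sum_add_distrib, h1, h2]

/-- Contraction of the divergence with a vector of an orthogonal eigenframe. -/
theorem divergence_contract_eigenframe {dK dH dP : Fin 3 → Fin 3 → Fin 3 → ℝ}
    {K H P dp dc : Fin 3 → Fin 3 → ℝ} {p q : Fin 3 → ℝ}
    (hHs : ∀ i m, H i m = H m i)
    (hK : ∀ B i, ∑ k, P B k * K k i = p B * P B i)
    (hdual : ∀ i l, ∑ B, q B * (∑ n, H i n * P B n) * P B l = if i = l then 1 else 0)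
    (hdK : ∀ l B j, ∑ i, (dP l B i * K i j + P B i * dK l i j) = dp l B * P B j + p B * dP l B j)
    (hdc : ∀ l B, dc l B = ∑ i, ∑ j, ((dP l B i * P B j + P B i * dP l B j) * H i j
      + P B i * P B j * dH l i j)) (A : Fin 3) :
    ∑ j, P A j * (∑ l, dK l j l
        + 1 / 2 * ∑ l, K j l * ∑ B, q B * ∑ k, ∑ m, P B k * P B m * dH l k m
        - 1 / 2 * ∑ B, p B * (q B * ∑ k, ∑ m, P B k * P B m * dH j k m)) =
    ∑ l, P A l * dp l A + ∑ B, (p A - p B) * (q B * (1 / 2 * ∑ l, P A l * dc l B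
      + ∑ m, (∑ i, (P B i * dP i A m - P A i * dP i B m)) * ∑ n, H m n * P B n)) := by
  -- The dual coframe, obtained by lowering the index of `P B` and normalising; in it K is the sum
  -- of `p B • θ B ⊗ P B`.
  set θ : Fin 3 → Fin 3 → ℝ := fun B i => q B * ∑ n, H i n * P B n with hθ
  set S : Fin 3 → Fin 3 → ℝ := fun l B => q B * ∑ k, ∑ m, P B k * P B m * dH l k m with hS
  have hKθ : ∀ i l, K i l = ∑ B, θ B i * (p B * P B l) := by
    intro i l
    have d0 := hdual i 0
    have d1 := hdual i 1
    have d2 := hdual i 2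
    have e0 : K i l = (if i = 0 then 1 else 0) * K 0 l + (if i = 1 then 1 else 0) * K 1 l
        + (if i = 2 then 1 else 0) * K 2 l := by
      fin_cases i <;> simp
    rw [e0, ← d0, ← d1, ← d2]
    simp only [← hK, hθ, Fin.sum_univ_three]
    ring
  have hθP : ∀ i l, ∑ B, θ B i * P B l = if i = l then 1 else 0 := hdual
  -- Tracing the differentiated eigenvector equation moves the derivative from K to the frame. Both
  -- resulting terms are expanded in the coframe, which produces the factors `p A - p B`.
  have h1 : ∑ j, P A j * ∑ l, dK l j l =
      ∑ l, P A l * dp l A + ∑ B, (p A - p B) * ∑ l, ∑ i, P B l * dP l A i * θ B i := by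
    have e1 : ∑ j, P A j * ∑ l, dK l j l = ∑ l, (dp l A * P A l + p A * dP l A l) -
        ∑ l, ∑ i, dP l A i * K i l := by
      rw [Finset.sum_congr rfl fun l _ => (hdK l A l).symm]
      simp only [Fin.sum_univ_three]
      ring
    have e2 : ∑ l, ∑ i, dP l A i * K i l =
        ∑ B, p B * ∑ l, ∑ i, P B l * dP l A i * θ B i := by
      simp only [hKθ, Fin.sum_univ_three]
      ring
    have e3 : ∑ l, dP l A l = ∑ B, ∑ l, ∑ i, P B l * dP l A i * θ B i := by
      have e4 : ∑ l, dP l A l = ∑ l, ∑ i, dP l A i * (if i = l then 1 else 0) := by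
        simp
      rw [e4]
      simp only [← hθP, Fin.sum_univ_three]
      ring
    rw [e1, e2, Finset.sum_add_distrib, ← Finset.mul_sum, e3]
    simp only [sub_mul, Finset.sum_sub_distrib, ← Finset.mul_sum, mul_comm (dp _ A)]
    ring
  have h2 : ∑ j, P A j * ∑ l, K j l * ∑ B, S l B = p A * ∑ l, P A l * ∑ B, S l B := by
    have h0 := hK A 0
    have h1 := hK A 1
    have h2 := hK A 2
    simp only [Fin.sum_univ_three] at h0 h1 h2 ⊢
    linear_combination (S 0 0 + S 0 1 + S 0 2) * h0 + (S 1 0 + S 1 1 + S 1 2) * h1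
      + (S 2 0 + S 2 1 + S 2 2) * h2
  -- The Leibniz rule for the squared length of `P B`. The term in which the frame is differentiated
  -- cancels against the part of the bracket in `h4` that differentiates `P B` along `P A`.
  have h3 : ∀ B, q B * (1 / 2 * ∑ l, P A l * dc l B) =
      1 / 2 * (∑ l, P A l * S l B) + ∑ l, ∑ i, P A l * dP l B i * θ B i := by
    intro B
    have e1 : ∀ l, q B * dc l B = S l B + 2 * ∑ i, dP l B i * θ B i := by
      intro l
      rw [hdc]
      simp only [hS, hθ, Fin.sum_univ_three, hHs 1 0, hHs 2 0, hHs 2 1]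
      ring
    have e2 : q B * (1 / 2 * ∑ l, P A l * dc l B) = 1 / 2 * ∑ l, P A l * (q B * dc l B) := by
      simp only [Fin.sum_univ_three]
      ring
    rw [e2]
    simp only [e1, Fin.sum_univ_three]
    ring
  have h4 : ∀ B, q B * ∑ m, (∑ i, (P B i * dP i A m - P A i * dP i B m)) * ∑ n, H m n * P B n =
      ∑ l, ∑ i, P B l * dP l A i * θ B i - ∑ l, ∑ i, P A l * dP l B i * θ B i := by
    intro B
    simp only [hθ, Fin.sum_univ_three]
    ring
  have h5 : ∀ B, q B * (1 / 2 * ∑ l, P A l * dc l B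
      + ∑ m, (∑ i, (P B i * dP i A m - P A i * dP i B m)) * ∑ n, H m n * P B n) =
      1 / 2 * (∑ l, P A l * S l B) + ∑ l, ∑ i, P B l * dP l A i * θ B i := by
    intro B
    rw [mul_add, h3, h4]
    ring
  simp only [h5]
  have h6 : ∑ j, P A j * (∑ l, dK l j l + 1 / 2 * ∑ l, K j l * ∑ B, S l B
        - 1 / 2 * ∑ B, p B * S j B) = ∑ j, P A j * ∑ l, dK l j l
        + 1 / 2 * (∑ j, P A j * ∑ l, K j l * ∑ B, S l B)
        - 1 / 2 * ∑ B, p B * ∑ l, P A l * S l B := by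
    simp only [Fin.sum_univ_three]
    ring
  rw [h6, h1, h2]
  simp only [Fin.sum_univ_three]
  ring

end Algebra

/-! ### The divergence in an eigenframe and its independence of the chart -/

section Divergence

variable {M : Type*} [TopologicalSpace M] [ChartedSpace E3 M] [IsManifold (𝓡 3) ∞ M]
  {e : OpenPartialHomeomorph M E3} {x : M} {h : Metric M} {K : EndField M}
  {p : Fin 3 → M → ℝ} {X : Fin 3 → VField M}

theorem IsOrderedEigenvalues.ne (hp : IsOrderedEigenvalues K p) (x : M) {A B : Fin 3}
    (hAB : A ≠ B) : p A x ≠ p B x := by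
  obtain ⟨⟨h1, h2⟩, -⟩ := hp x
  fin_cases A <;> fin_cases B <;> simp at hAB ⊢ <;> linarith

theorem IsSymm.inner_eq_zero (hK : IsSymm h K) {v w : TangentSpace (𝓡 3) x} {a b : ℝ}
    (hv : K x v = a • v) (hw : K x w = b • w) (hab : a ≠ b) : h.inner x v w = 0 := by
  have h1 := hK x v w
  rw [hv, hw] at h1
  simp only [map_smul, smul_apply, smul_eq_mul] at h1
  have h2 : (a - b) * h.inner x v w = 0 := by linarith
  exact (mul_eq_zero.1 h2).resolve_left (sub_ne_zero.2 hab)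

theorem inner_eq_sum (h : Metric M) (he : e ∈ IsManifold.maximalAtlas (𝓡 3) ∞ M)
    (hx : x ∈ e.source) (v w : TangentSpace (𝓡 3) x) :
    h.inner x v w =
      ∑ i, ∑ j, coordCovec e i x v * coordCovec e j x w * metricMatrix e h x i j := by
  conv_lhs => rw [← sum_coordCovec_smul_coordVec he hx v, ← sum_coordCovec_smul_coordVec he hx w]
  simp only [map_sum, map_smul, sum_apply, smul_apply,
    smul_eq_mul, metricMatrix, Matrix.of_apply, Finset.mul_sum]
  rw [Finset.sum_comm]
  refine Finset.sum_congr rfl fun i _ => Finset.sum_congr rfl fun j _ => by ring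

theorem metricMatrix_symm (i j : Fin 3) : metricMatrix e h x i j = metricMatrix e h x j i :=
  h.symm x _ _

theorem coordCovec_end_apply (he : e ∈ IsManifold.maximalAtlas (𝓡 3) ∞ M) (hx : x ∈ e.source)
    (K : EndField M) (v : TangentSpace (𝓡 3) x) (j : Fin 3) :
    coordCovec e j x (K x v) = ∑ i, coordCovec e i x v * endComp e K i j x := by
  conv_lhs => rw [← sum_coordCovec_smul_coordVec he hx v]
  simp only [map_sum, map_smul, smul_eq_mul]
  rfl

/-- Smooth eigenvector fields of `K`, for the eigenvalues `p`, near the point `x`. -/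
structure IsEigenframeNear (K : EndField M) (p : Fin 3 → M → ℝ) (X : Fin 3 → VField M) (x : M) :
    Prop where
  smooth : ∀ A, SmoothVFieldAt (X A) x
  eig : ∀ᶠ y in 𝓝 x, ∀ A, K y (X A y) = p A y • X A y
  ne_zero : ∀ A, X A x ≠ 0

theorem IsEigenframeNear.inner_pos (hX : IsEigenframeNear K p X x) (h : Metric M) (A : Fin 3) :
    0 < h.inner x (X A x) (X A x) :=
  h.pos x _ (hX.ne_zero A)

/-- Near the point the eigenvalue is the Rayleigh quotient h(KX, X) / h(X, X) of a smooth
eigenvector field; no continuity of `p` is presupposed. -/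
theorem IsEigenframeNear.smoothAt_eigenvalue (hX : IsEigenframeNear K p X x)
    (hK : SmoothEndField K) (h : Metric M) (A : Fin 3) : SmoothAt (p A) x := by
  have hc := smoothAt_inner h (hX.smooth A) (hX.smooth A)
  have hn := smoothAt_inner h (smoothVFieldAt_end_apply hK (hX.smooth A)) (hX.smooth A)
  refine (hn.div hc (hX.inner_pos h A).ne').congr_of_eventuallyEq ?_
  filter_upwards [hX.eig, hc.continuousAt.eventually_ne (hX.inner_pos h A).ne'] with y hy hy0
  rw [hy A, map_smul, smul_apply, smul_eq_mul, mul_div_assoc, div_self hy0,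
    mul_one]

section Pointwise

variable (he : e ∈ IsManifold.maximalAtlas (𝓡 3) ∞ M) (hx : x ∈ e.source)
  (hK : IsSymm h K) (hp : IsOrderedEigenvalues K p)
  (hX : IsEigenframeNear K p X x)

include he hx hK hp hX

/-- Eigenvectors for distinct eigenvalues are orthogonal, so `P * H * Pᵀ` is diagonal with the
squared lengths as entries, where `P` holds the frame components; inverting this identity gives the
formula. -/
theorem metricMatrix_inv_eq (k m : Fin 3) :
    (metricMatrix e h x)⁻¹ k m = ∑ B, (h.inner x (X B x) (X B x))⁻¹ * coordCovec e k x (X B x) *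
      coordCovec e m x (X B x) := by
  let P : Matrix (Fin 3) (Fin 3) ℝ := Matrix.of fun A i => coordCovec e i x (X A x)
  let D : Matrix (Fin 3) (Fin 3) ℝ :=
    Matrix.diagonal fun A => (h.inner x (X A x) (X A x))⁻¹
  have h1 : P * metricMatrix e h x * P.transpose =
      Matrix.diagonal fun A => h.inner x (X A x) (X A x) := by
    ext A B
    have h2 : (P * metricMatrix e h x * P.transpose) A B = h.inner x (X A x) (X B x) := by
      rw [inner_eq_sum h he hx]
      simp only [Matrix.mul_apply, P, Matrix.transpose_apply, Matrix.of_apply, Finset.sum_mul]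
      rw [Finset.sum_comm]
      exact Finset.sum_congr rfl fun i _ => Finset.sum_congr rfl fun j _ => by ring
    rw [h2]
    by_cases hAB : A = B
    · subst hAB
      simp
    · rw [Matrix.diagonal_apply_ne _ hAB]
      exact hK.inner_eq_zero (hX.eig.self_of_nhds A) (hX.eig.self_of_nhds B) (hp.ne x hAB)
  have h3 : P * (metricMatrix e h x * (P.transpose * D)) = 1 := by
    rw [← Matrix.mul_assoc, ← Matrix.mul_assoc, h1, Matrix.diagonal_mul_diagonal]
    rw [← Matrix.diagonal_one]
    congr 1
    funext A
    exact mul_inv_cancel₀ (hX.inner_pos h A).ne'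
  have h4 : metricMatrix e h x * (P.transpose * D * P) = 1 := by
    rw [← Matrix.mul_assoc]
    exact mul_eq_one_comm.1 h3
  rw [Matrix.inv_eq_right_inv h4]
  rw [Matrix.mul_apply]
  refine Finset.sum_congr rfl fun B _ => ?_
  simp only [D, Matrix.mul_diagonal, P, Matrix.transpose_apply, Matrix.of_apply]
  ring

theorem sum_metricMatrix_dual (i l : Fin 3) :
    ∑ B, (h.inner x (X B x) (X B x))⁻¹ *
      (∑ n, metricMatrix e h x i n * coordCovec e n x (X B x)) * coordCovec e l x (X B x) =
      if i = l then 1 else 0 := by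
  have hdet : metricMatrix e h x * (metricMatrix e h x)⁻¹ = 1 := by
    refine Matrix.mul_nonsing_inv _ ?_
    rw [isUnit_iff_ne_zero]
    intro h0
    have h1 := metricMatrix_inv_eq he hx hK hp hX
    -- A singular matrix has inverse zero by convention. The diagonal entries in `h1` would then be
    -- vanishing sums of nonnegative terms, forcing `X 0 x = 0`.
    rw [Matrix.nonsing_inv_apply_not_isUnit _ (by simp [h0])] at h1
    have h2 : h.inner x (X 0 x) (X 0 x) = 0 := by
      have h3 : ∀ k, coordCovec e k x (X 0 x) = 0 := by
        intro k
        have h4 := h1 k k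
        rw [Matrix.zero_apply] at h4
        have h5 := (Finset.sum_eq_zero_iff_of_nonneg fun B _ => by
          rw [mul_assoc]
          exact mul_nonneg (inv_nonneg.2 (hX.inner_pos h B).le) (mul_self_nonneg _)).1 h4.symm 0
            (Finset.mem_univ _)
        rw [mul_assoc] at h5
        exact mul_self_eq_zero.1 ((mul_eq_zero.1 h5).resolve_left
          (inv_ne_zero (hX.inner_pos h 0).ne'))
      rw [inner_eq_sum h he hx]
      simp [h3]
    exact (hX.inner_pos h 0).ne' h2
  have h1 := congrFun (congrFun hdet i) l
  rw [Matrix.mul_apply, Matrix.one_apply] at h1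
  rw [← h1]
  simp only [metricMatrix_inv_eq he hx hK hp hX, Fin.sum_univ_three]
  ring

omit hK hp in
theorem sum_coordCovec_mul_endComp (B i : Fin 3) :
    ∑ k, coordCovec e k x (X B x) * endComp e K k i x = p B x * coordCovec e i x (X B x) := by
  rw [← coordCovec_end_apply he hx, hX.eig.self_of_nhds B, map_smul, smul_eq_mul]

/-- The divergence in an orthogonal eigenframe. -/
theorem divComp_eq (j : Fin 3) :
    divComp e h K j x = ∑ l, pderiv e l (endComp e K j l) x
      + 1 / 2 * ∑ l, endComp e K j l x * ∑ B, (h.inner x (X B x) (X B x))⁻¹ *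
          ∑ k, ∑ m, coordCovec e k x (X B x) * coordCovec e m x (X B x) *
            pderiv e l (fun y => metricMatrix e h y k m) x
      - 1 / 2 * ∑ B, p B x * ((h.inner x (X B x) (X B x))⁻¹ *
          ∑ k, ∑ m, coordCovec e k x (X B x) * coordCovec e m x (X B x) *
            pderiv e j (fun y => metricMatrix e h y k m) x) :=
  divergence_eq_of_eigenframe (dK := fun l i j => pderiv e l (endComp e K i j) x)
    (dH := fun l i j => pderiv e l (fun y => metricMatrix e h y i j) x)
    (K := fun i j => endComp e K i j x) (G := fun k m => (metricMatrix e h x)⁻¹ k m)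
    (P := fun A i => coordCovec e i x (X A x)) (p := fun A => p A x)
    (q := fun B => (h.inner x (X B x) (X B x))⁻¹)
    (fun l i m => by
      have : (fun y => metricMatrix e h y i m) = fun y => metricMatrix e h y m i :=
        funext fun y => metricMatrix_symm i m
      simp only [this])
    (metricMatrix_inv_eq he hx hK hp hX) (sum_coordCovec_mul_endComp he hx hX) j

end Pointwise

theorem pderiv_inner (he : e ∈ IsManifold.maximalAtlas (𝓡 3) ∞ M) (hx : x ∈ e.source)
    {Y : VField M} (hY : SmoothVFieldAt Y x) (l : Fin 3) :
    pderiv e l (fun y => h.inner y (Y y) (Y y)) x = ∑ i, ∑ j,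
      ((pderiv e l (fun y => coordCovec e i y (Y y)) x * coordCovec e j x (Y x)
        + coordCovec e i x (Y x) * pderiv e l (fun y => coordCovec e j y (Y y)) x)
          * metricMatrix e h x i j
      + coordCovec e i x (Y x) * coordCovec e j x (Y x) *
        pderiv e l (fun y => metricMatrix e h y i j) x) := by
  have hs : ∀ i, SmoothAt (fun y => coordCovec e i y (Y y)) x :=
    contMDiffAt_coordCovec he hx hY
  have hH := smoothAt_metricMatrix h he hx
  have h1 : (fun y => h.inner y (Y y) (Y y)) =ᶠ[𝓝 x] fun y => ∑ i, ∑ j,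
      coordCovec e i y (Y y) * coordCovec e j y (Y y) * metricMatrix e h y i j := by
    filter_upwards [e.open_source.mem_nhds hx] with y hy using inner_eq_sum h he hy _ _
  have hs2 : ∀ i j, SmoothAt (fun y => coordCovec e i y (Y y) * coordCovec e j y (Y y) *
      metricMatrix e h y i j) x := fun i j => ((hs i).mul (hs j)).mul (hH i j)
  rw [pderiv_congr hx h1, pderiv_sum he hx (fun i => contMDiffAt_finsetSum fun j _ => hs2 i j)]
  refine Finset.sum_congr rfl fun i _ => ?_
  rw [pderiv_sum he hx (hs2 i)]
  refine Finset.sum_congr rfl fun j _ => ?_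
  rw [pderiv_mul he hx ((hs i).mul (hs j)) (hH i j), pderiv_mul he hx (hs i) (hs j)]

/-- The derivative of a function along a tangent vector. -/
def dirDeriv (f : M → ℝ) (x : M) (v : TangentSpace (𝓡 3) x) : ℝ :=
  mfderiv (𝓡 3) 𝓘(ℝ, ℝ) f x v

theorem sum_coordCovec_mul_pderiv_eq_dirDeriv (he : e ∈ IsManifold.maximalAtlas (𝓡 3) ∞ M)
    (hx : x ∈ e.source) {f : M → ℝ} (hf : SmoothAt f x) (v : TangentSpace (𝓡 3) x) :
    ∑ i, coordCovec e i x v * pderiv e i f x = dirDeriv f x v :=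
  sum_coordCovec_mul_pderiv he hx hf v

/-- The contraction of the divergence of `K` with the vector `X A` of an eigenframe, expressed
without coordinates. -/
def frameDiv (h : Metric M) (p : Fin 3 → M → ℝ) (X : Fin 3 → VField M) (A : Fin 3) (x : M) : ℝ :=
  dirDeriv (p A) x (X A x) + ∑ B, (p A x - p B x) *
    ((h.inner x (X B x) (X B x))⁻¹ *
      (1 / 2 * dirDeriv (fun y => h.inner y (X B y) (X B y)) x (X A x)
        + h.inner x (VectorField.mlieBracket (𝓡 3) (X B) (X A) x) (X B x)))

theorem sum_coordCovec_mul_divComp (he : e ∈ IsManifold.maximalAtlas (𝓡 3) ∞ M)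
    (hx : x ∈ e.source) (hKs : SmoothEndField K) (hK : IsSymm h K) (hp : IsOrderedEigenvalues K p)
    (hX : IsEigenframeNear K p X x) (A : Fin 3) :
    ∑ j, coordCovec e j x (X A x) * divComp e h K j x = frameDiv h p X A x := by
  have hsP : ∀ B i, SmoothAt (fun y => coordCovec e i y (X B y)) x := fun B i =>
    contMDiffAt_coordCovec he hx (hX.smooth B) i
  have hsK := fun i j => smoothAt_endComp hKs he hx i j
  have hsp := hX.smoothAt_eigenvalue hKs h
  have hmain := divergence_contract_eigenframe
    (dK := fun l i j => pderiv e l (endComp e K i j) x)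
    (dH := fun l i j => pderiv e l (fun y => metricMatrix e h y i j) x)
    (dP := fun l B i => pderiv e l (fun y => coordCovec e i y (X B y)) x)
    (K := fun i j => endComp e K i j x) (H := fun i j => metricMatrix e h x i j)
    (P := fun A i => coordCovec e i x (X A x))
    (dp := fun l B => pderiv e l (p B) x)
    (dc := fun l B => pderiv e l (fun y => h.inner y (X B y) (X B y)) x)
    (p := fun A => p A x)
    (q := fun B => (h.inner x (X B x) (X B x))⁻¹)
    (fun i m => metricMatrix_symm i m) (sum_coordCovec_mul_endComp he hx hX)
    (sum_metricMatrix_dual he hx hK hp hX)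
    (fun l B j => by
      have h1 : (fun y => ∑ i, coordCovec e i y (X B y) * endComp e K i j y) =ᶠ[𝓝 x]
          fun y => p B y * coordCovec e j y (X B y) := by
        filter_upwards [hX.eig, e.open_source.mem_nhds hx] with y hy hys
        rw [← coordCovec_end_apply he hys, hy B, map_smul, smul_eq_mul]
      have h2 := pderiv_congr hx h1 l
      rw [pderiv_sum he hx fun i => (hsP B i).mul (hsK i j),
        pderiv_mul he hx (hsp B) (hsP B j)] at h2
      rw [← h2]
      exact Finset.sum_congr rfl fun i _ => (pderiv_mul he hx (hsP B i) (hsK i j) l).symm)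
    (fun l B => pderiv_inner he hx (hX.smooth B) l) A
  simp only [← divComp_eq he hx hK hp hX] at hmain
  rw [hmain, frameDiv, ← sum_coordCovec_mul_pderiv_eq_dirDeriv he hx (hsp A)]
  congr 1
  refine Finset.sum_congr rfl fun B _ => ?_
  congr 2
  rw [← sum_coordCovec_mul_pderiv_eq_dirDeriv he hx (smoothAt_inner h (hX.smooth B) (hX.smooth B))]
  congr 1
  rw [inner_eq_sum h he hx]
  simp only [coordCovec_mlieBracket he hx (hX.smooth B) (hX.smooth A), Finset.mul_sum]
  refine Finset.sum_congr rfl fun m _ => Finset.sum_congr rfl fun n _ => ?_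
  ring

/-- A family of eigenvectors for the three distinct eigenvalues is linearly independent. -/
theorem IsOrderedEigenvalues.linearIndependent (hp : IsOrderedEigenvalues K p)
    {v : Fin 3 → TangentSpace (𝓡 3) x} (hv : ∀ A, K x (v A) = p A x • v A) (h0 : ∀ A, v A ≠ 0) :
    LinearIndependent ℝ v :=
  Module.End.eigenvectors_linearIndependent' (K x : Module.End ℝ (TangentSpace (𝓡 3) x))
    (fun A => p A x) (fun A B hAB => by
      by_contra hne
      exact hp.ne x hne hAB) v
    (fun A => ⟨Module.End.mem_eigenspace_iff.2 (hv A), h0 A⟩)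

theorem IsEigenframeNear.linearIndependent (hX : IsEigenframeNear K p X x)
    (hp : IsOrderedEigenvalues K p) : LinearIndependent ℝ fun A => X A x :=
  hp.linearIndependent hX.eig.self_of_nhds hX.ne_zero

/-- The vectors of an eigenframe as a basis of the tangent space. -/
def IsEigenframeNear.basis (hX : IsEigenframeNear K p X x) (hp : IsOrderedEigenvalues K p) :
    Module.Basis (Fin 3) ℝ (TangentSpace (𝓡 3) x) :=
  basisOfLinearIndependentOfCardEqFinrank (hX.linearIndependent hp)
    (show Fintype.card (Fin 3) = Module.finrank ℝ E3 by simp)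

theorem IsEigenframeNear.basis_apply (hX : IsEigenframeNear K p X x)
    (hp : IsOrderedEigenvalues K p) (A : Fin 3) : hX.basis hp A = X A x :=
  congrFun (coe_basisOfLinearIndependentOfCardEqFinrank _ _) A

/-- The eigenvectors span the tangent space, so a covector vanishes exactly when its values on them
do. The right-hand side does not involve the chart. -/
theorem divComp_eq_zero_iff (he : e ∈ IsManifold.maximalAtlas (𝓡 3) ∞ M)
    (hx : x ∈ e.source) (hKs : SmoothEndField K) (hK : IsSymm h K) (hp : IsOrderedEigenvalues K p)
    (hX : IsEigenframeNear K p X x) :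
    (∀ j, divComp e h K j x = 0) ↔ ∀ A, frameDiv h p X A x = 0 := by
  refine ⟨fun h0 A => ?_, fun h0 j => ?_⟩
  · rw [← sum_coordCovec_mul_divComp he hx hKs hK hp hX]
    simp [h0]
  · have h1 : ∀ v : TangentSpace (𝓡 3) x, ∑ j, coordCovec e j x v * divComp e h K j x = 0 := by
      intro v
      have h2 : (∑ j, divComp e h K j x • (coordCovec e j x : TangentSpace (𝓡 3) x →ₗ[ℝ] ℝ)) = 0 := by
        refine (hX.basis hp).ext fun A => ?_
        have h3 := sum_coordCovec_mul_divComp he hx hKs hK hp hX A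
        rw [h0 A] at h3
        rw [hX.basis_apply hp]
        simpa [mul_comm] using h3
      have h4 := LinearMap.congr_fun h2 v
      simpa [mul_comm] using h4
    have h5 := h1 (coordVec e j x)
    simp only [coordCovec_coordVec he hx] at h5
    simpa using h5

/-- Two charts are compared through the chart-free `frameDiv`, which avoids the transformation law
of the Christoffel symbols. -/
theorem divFreeAt_iff (he : e ∈ IsManifold.maximalAtlas (𝓡 3) ∞ M)
    (hx : x ∈ e.source) (hKs : SmoothEndField K) (hK : IsSymm h K) (hp : IsOrderedEigenvalues K p)
    (hX : IsEigenframeNear K p X x) :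
    DivFreeAt h K x ↔ ∀ j, divComp e h K j x = 0 :=
  ⟨fun h0 => h0 e he hx, fun h0 _ he' hx' => (divComp_eq_zero_iff he' hx' hKs hK hp hX).2
    ((divComp_eq_zero_iff he hx hKs hK hp hX).1 h0)⟩

end Divergence

/-! ### Adapted charts and the momentum condition -/

section Triangular

variable {M : Type*} [TopologicalSpace M] [ChartedSpace E3 M] [IsManifold (𝓡 3) ∞ M]
  {e : OpenPartialHomeomorph M E3} {x : M} {h : Metric M} {K : EndField M}
  {p : Fin 3 → M → ℝ}

theorem triFrame_zero : triFrame e K p 0 x =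
    coordVec e 0 x + X12 e K p x • coordVec e 1 x + X13 e K p x • coordVec e 2 x := rfl

theorem triFrame_one : triFrame e K p 1 x = coordVec e 1 x + X23 e K p x • coordVec e 2 x := rfl

theorem triFrame_two : triFrame e K p 2 x = coordVec e 2 x := rfl

/-- The components of the triangular frame. -/
theorem coordCovec_triFrame (he : e ∈ IsManifold.maximalAtlas (𝓡 3) ∞ M) (hx : x ∈ e.source)
    (A i : Fin 3) : coordCovec e i x (triFrame e K p A x) =
      !![1, X12 e K p x, X13 e K p x; 0, 1, X23 e K p x; 0, 0, 1] A i := by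
  fin_cases A
  · change coordCovec e i x (triFrame e K p 0 x) = _
    rw [triFrame_zero, map_add, map_add, map_smul, map_smul]
    simp only [coordCovec_coordVec he hx]
    fin_cases i <;> simp
  · change coordCovec e i x (triFrame e K p 1 x) = _
    rw [triFrame_one, map_add, map_smul]
    simp only [coordCovec_coordVec he hx]
    fin_cases i <;> simp
  · change coordCovec e i x (triFrame e K p 2 x) = _
    rw [triFrame_two]
    simp only [coordCovec_coordVec he hx]
    fin_cases i <;> simp

/-- The matrix of `K` in the chart is upper triangular with diagonal `p`. -/
def IsUpperTriangularAt (e : OpenPartialHomeomorph M E3) (K : EndField M) (p : Fin 3 → M → ℝ)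
    (x : M) : Prop :=
  (∀ i, endComp e K i i x = p i x) ∧
    endComp e K 1 0 x = 0 ∧ endComp e K 2 0 x = 0 ∧ endComp e K 2 1 x = 0

/-- The eigenvector equations are read from the last frame vector to the first; each yields one row
of the matrix, given the rows below it. -/
theorem IsTriangularChart.isUpperTriangularAt (ht : IsTriangularChart e K p)
    (he : e ∈ IsManifold.maximalAtlas (𝓡 3) ∞ M) (hx : x ∈ e.source) :
    IsUpperTriangularAt e K p x := by
  have key : ∀ A j, ∑ i, coordCovec e i x (triFrame e K p A x) * endComp e K i j x =
      p A x * coordCovec e j x (triFrame e K p A x) := by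
    intro A j
    rw [← coordCovec_end_apply he hx, ht.2 x hx A, map_smul, smul_eq_mul]
  simp only [coordCovec_triFrame he hx, Fin.sum_univ_three] at key
  have k20 := key 2 0
  have k21 := key 2 1
  have k22 := key 2 2
  have k10 := key 1 0
  have k11 := key 1 1
  have k00 := key 0 0
  simp at k20 k21 k22 k10 k11 k00
  rw [k20, mul_zero, add_zero] at k10
  rw [k21, mul_zero, add_zero] at k11
  rw [k10, k20, mul_zero, mul_zero, add_zero, add_zero] at k00
  refine ⟨fun i => ?_, k10, k20, k21⟩
  fin_cases i
  exacts [k00, k11, k22]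

/-- In a chart in which `K` is upper triangular, the triangular frame consists of eigenvectors. -/
theorem IsUpperTriangularAt.end_triFrame (ht : IsUpperTriangularAt e K p x)
    (he : e ∈ IsManifold.maximalAtlas (𝓡 3) ∞ M) (hx : x ∈ e.source)
    (hp : IsOrderedEigenvalues K p) (A : Fin 3) :
    K x (triFrame e K p A x) = p A x • triFrame e K p A x := by
  obtain ⟨hd, h10, h20, h21⟩ := ht
  have p01 := sub_ne_zero.2 (hp.ne x (show (0 : Fin 3) ≠ 1 by decide))
  have p02 := sub_ne_zero.2 (hp.ne x (show (0 : Fin 3) ≠ 2 by decide))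
  have p12 := sub_ne_zero.2 (hp.ne x (show (1 : Fin 3) ≠ 2 by decide))
  refine tangent_ext he hx fun j => ?_
  rw [coordCovec_end_apply he hx, map_smul, smul_eq_mul]
  simp only [coordCovec_triFrame he hx, Fin.sum_univ_three]
  have hd0 := hd 0
  have hd1 := hd 1
  have hd2 := hd 2
  fin_cases A <;> fin_cases j <;> simp [h10, h20, h21, hd0, hd1, hd2, X12, X13, X23] <;>
    field_simp <;> ring

theorem IsTriangularChart.isEigenframeNear (ht : IsTriangularChart e K p) (hx : x ∈ e.source) :
    IsEigenframeNear K p (triFrame e K p) x where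
  smooth A := ht.1.contMDiffAt e.open_source hx A
  eig := by
    filter_upwards [e.open_source.mem_nhds hx] with y hy using ht.2 y hy
  ne_zero A := (ht.1.linearIndependent hx).ne_zero A

theorem cFun_diag (A : Fin 3) : cFun e h K p A A = cDiag e h K p A := by
  funext y
  fin_cases A <;> rfl

/-- The lengths c_AA cancel from every entry. In the corner entry the two products K_1^2 K_2^3 /
(p_3 - p_2), one from c_12 c_23 and one from c_13, cancel as well. -/
theorem kappa_eq_neg_endComp (ht : IsUpperTriangularAt e K p x) (hp : IsOrderedEigenvalues K p)
    (hc : ∀ A, cDiag e h K p A x ≠ 0) (i l : Fin 3) :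
    kappa p (cFun e h K p) i l x = -endComp e K i l x := by
  obtain ⟨hd, h10, h20, h21⟩ := ht
  have p01 := sub_ne_zero.2 (hp.ne x (show (1 : Fin 3) ≠ 0 by decide))
  have p02 := sub_ne_zero.2 (hp.ne x (show (2 : Fin 3) ≠ 0 by decide))
  have p12 := sub_ne_zero.2 (hp.ne x (show (2 : Fin 3) ≠ 1 by decide))
  have c1 := hc 1
  have c2 := hc 2
  have hd0 := hd 0
  have hd1 := hd 1
  have hd2 := hd 2
  fin_cases i <;> fin_cases l <;>
    simp [kappa, cFun, c12, c13, c23, h10, h20, h21, hd0, hd1, hd2] <;> field_simp <;> ring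

/-- The components of the covectors `h(∂_i, ·)` on the triangular frame. -/
theorem IsTriangularChart.inner_coordVec_triFrame (ht : IsTriangularChart e K p)
    (hx : x ∈ e.source) (hK : IsSymm h K) (hp : IsOrderedEigenvalues K p) :
    h.inner x (coordVec e 1 x) (triFrame e K p 0 x) = 0 ∧
      h.inner x (coordVec e 2 x) (triFrame e K p 0 x) = 0 ∧
      h.inner x (coordVec e 2 x) (triFrame e K p 1 x) = 0 := by
  have horth : ∀ A B, A ≠ B → h.inner x (triFrame e K p A x) (triFrame e K p B x) = 0 :=
    fun A B hAB => hK.inner_eq_zero (ht.2 x hx A) (ht.2 x hx B) (hp.ne x hAB)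
  have h20 := horth 2 0 (by decide)
  have h21 := horth 2 1 (by decide)
  have h10 := horth 1 0 (by decide)
  rw [triFrame_two] at h20 h21
  refine ⟨?_, h20, h21⟩
  have h1 : coordVec e 1 x = triFrame e K p 1 x - X23 e K p x • coordVec e 2 x := by
    rw [triFrame_one, add_sub_cancel_right]
  rw [h1, map_sub, map_smul, sub_apply, smul_apply, h10, h20, smul_zero, sub_zero]

/-- Derivatives of the frame components do not contribute: the leading component of X_B is the
constant 1, so ∂_l X_B involves only the later coordinate vectors. These span the same space as the
later frame vectors and are orthogonal to X_B. -/
theorem IsTriangularChart.pderiv_cDiag (ht : IsTriangularChart e K p)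
    (he : e ∈ IsManifold.maximalAtlas (𝓡 3) ∞ M) (hx : x ∈ e.source) (hK : IsSymm h K)
    (hp : IsOrderedEigenvalues K p) (l B : Fin 3) :
    pderiv e l (cDiag e h K p B) x = ∑ k, ∑ m, coordCovec e k x (triFrame e K p B x) *
      coordCovec e m x (triFrame e K p B x) * pderiv e l (fun y => metricMatrix e h y k m) x := by
  have hX := ht.isEigenframeNear hx
  have h0 := pderiv_inner (h := h) he hx (hX.smooth B) l
  have hw : ∀ i, ∑ j, coordCovec e j x (triFrame e K p B x) * metricMatrix e h x i j =
      h.inner x (coordVec e i x) (triFrame e K p B x) := by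
    intro i
    rw [inner_eq_sum h he hx]
    simp only [coordCovec_coordVec he hx]
    simp
  have hsplit : ∑ i, ∑ j, (pderiv e l (fun y => coordCovec e i y (triFrame e K p B y)) x *
        coordCovec e j x (triFrame e K p B x) + coordCovec e i x (triFrame e K p B x) *
        pderiv e l (fun y => coordCovec e j y (triFrame e K p B y)) x) * metricMatrix e h x i j =
      2 * ∑ i, pderiv e l (fun y => coordCovec e i y (triFrame e K p B y)) x *
        h.inner x (coordVec e i x) (triFrame e K p B x) := by
    simp only [← hw, Fin.sum_univ_three]
    rw [metricMatrix_symm (e := e) (h := h) 1 0, metricMatrix_symm (e := e) (h := h) 2 0,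
      metricMatrix_symm (e := e) (h := h) 2 1]
    ring
  have hconst : ∀ i (c : ℝ), (∀ y ∈ e.source, coordCovec e i y (triFrame e K p B y) = c) →
      pderiv e l (fun y => coordCovec e i y (triFrame e K p B y)) x = 0 := by
    intro i c hc
    have h1 : (fun y => coordCovec e i y (triFrame e K p B y)) =ᶠ[𝓝 x] fun _ => c := by
      filter_upwards [e.open_source.mem_nhds hx] with y hy using hc y hy
    rw [pderiv_congr hx h1, pderiv_const]
  have hzero : ∑ i, pderiv e l (fun y => coordCovec e i y (triFrame e K p B y)) x *
        h.inner x (coordVec e i x) (triFrame e K p B x) = 0 := by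
    obtain ⟨h10, h20, h21⟩ := ht.inner_coordVec_triFrame hx hK hp
    rw [Fin.sum_univ_three]
    fin_cases B
    · change _ * _ + _ * h.inner x (coordVec e 1 x) (triFrame e K p 0 x) +
        _ * h.inner x (coordVec e 2 x) (triFrame e K p 0 x) = 0
      rw [h10, h20, hconst 0 1 fun y hy => by rw [coordCovec_triFrame he hy]; rfl]
      ring
    · change _ * _ + _ * _ + _ * h.inner x (coordVec e 2 x) (triFrame e K p 1 x) = 0
      rw [h21, hconst 0 0 fun y hy => by rw [coordCovec_triFrame he hy]; rfl,
        hconst 1 1 fun y hy => by rw [coordCovec_triFrame he hy]; rfl]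
      ring
    · rw [hconst 0 0 fun y hy => by rw [coordCovec_triFrame he hy]; rfl,
        hconst 1 0 fun y hy => by rw [coordCovec_triFrame he hy]; rfl,
        hconst 2 1 fun y hy => by rw [coordCovec_triFrame he hy]; rfl]
      ring
  have h1 : pderiv e l (cDiag e h K p B) x = _ := h0
  rw [h1]
  simp only [Finset.sum_add_distrib] at hsplit ⊢
  rw [hsplit, hzero]
  ring

/-- By `divComp_eq` and `pderiv_cDiag`, the divergence is ∂_l K_i^l plus half of K_i^l ∂_l log(c_11
c_22 c_33), minus half of the sum of p_B ∂_i log c_BB. The diagonal part l = i of the second term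
joins the third to give the factors p_l - p_i; the part l > i is the indicator term, and l < i drops
out by triangularity. -/
theorem momentum_sum_eq (ht : IsTriangularChart e K p)
    (he : e ∈ IsManifold.maximalAtlas (𝓡 3) ∞ M) (hx : x ∈ e.source) (hK : IsSymm h K)
    (hp : IsOrderedEigenvalues K p) (i : Fin 3) :
    ∑ l, (pderiv e i (cFun e h K p l l) x / cFun e h K p l l x * (p l x - p i x)
      + 2 * pderiv e l (kappa p (cFun e h K p) i l) x
      + if i < l then
          pderiv e l (fun y => cFun e h K p 0 0 y * cFun e h K p 1 1 y * cFun e h K p 2 2 y) x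
            / (cFun e h K p 0 0 x * cFun e h K p 1 1 x * cFun e h K p 2 2 x)
            * kappa p (cFun e h K p) i l x
        else 0) = -2 * divComp e h K i x := by
  have hX := ht.isEigenframeNear hx
  have hcpos : ∀ y ∈ e.source, ∀ A, cDiag e h K p A y ≠ 0 := fun y hy A =>
    ((ht.isEigenframeNear hy).inner_pos h A).ne'
  have hc := hcpos x hx
  have hcs : ∀ A, SmoothAt (cDiag e h K p A) x := fun A =>
    smoothAt_inner h (hX.smooth A) (hX.smooth A)
  have hk : ∀ l, pderiv e l (kappa p (cFun e h K p) i l) x = -pderiv e l (endComp e K i l) x := by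
    intro l
    have h1 : kappa p (cFun e h K p) i l =ᶠ[𝓝 x] fun y => -endComp e K i l y := by
      filter_upwards [e.open_source.mem_nhds hx] with y hy
      exact kappa_eq_neg_endComp (ht.isUpperTriangularAt he hy) hp (hcpos y hy) i l
    rw [pderiv_congr hx h1, pderiv_neg]
  have hlog : ∀ l, pderiv e l (fun y => cDiag e h K p 0 y * cDiag e h K p 1 y *
      cDiag e h K p 2 y) x / (cDiag e h K p 0 x * cDiag e h K p 1 x * cDiag e h K p 2 x) =
      ∑ B, (cDiag e h K p B x)⁻¹ * pderiv e l (cDiag e h K p B) x := by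
    intro l
    rw [pderiv_mul he hx ((hcs 0).mul (hcs 1)) (hcs 2), pderiv_mul he hx (hcs 0) (hcs 1),
      Fin.sum_univ_three]
    have c0 := hc 0
    have c1 := hc 1
    have c2 := hc 2
    field_simp
  have hdiv := divComp_eq he hx hK hp hX i
  simp only [← ht.pderiv_cDiag he hx hK hp] at hdiv
  have hq : ∀ B, h.inner x (triFrame e K p B x) (triFrame e K p B x) = cDiag e h K p B x :=
    fun B => rfl
  simp only [hq] at hdiv
  simp only [cFun_diag, hk, hlog, kappa_eq_neg_endComp (ht.isUpperTriangularAt he hx) hp hc, hdiv,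
    div_eq_inv_mul]
  obtain ⟨hd, h10, h20, h21⟩ := ht.isUpperTriangularAt he hx
  have hd0 := hd 0
  have hd1 := hd 1
  have hd2 := hd 2
  simp only [Fin.sum_univ_three]
  fin_cases i
  · simp [hd0]
    ring
  · simp [hd1, h10]
    ring
  · simp [hd2, h20, h21]
    ring

/-- In an adapted chart, the momentum condition says that `K` is divergence free. -/
theorem momentumCondAt_iff_divFreeAt (ht : IsTriangularChart e K p)
    (he : e ∈ IsManifold.maximalAtlas (𝓡 3) ∞ M) (hx : x ∈ e.source) (hKs : SmoothEndField K)
    (hK : IsSymm h K) (hp : IsOrderedEigenvalues K p) :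
    MomentumCondAt e p (cFun e h K p) x ↔ DivFreeAt h K x := by
  rw [divFreeAt_iff he hx hKs hK hp (ht.isEigenframeNear hx), MomentumCondAt]
  refine forall_congr' fun i => ?_
  rw [momentum_sum_eq ht he hx hK hp i]
  simp

end Triangular

/-! ### Smooth dependence of simple eigenvalues and their eigenvectors -/

/-- A simple eigenvalue and its eigenvector depend smoothly on parameters. -/
theorem exists_smooth_eigenpair {E F : Type*} [NormedAddCommGroup E] [NormedSpace ℝ E]
    [FiniteDimensional ℝ E] [NormedAddCommGroup F] [NormedSpace ℝ F] [FiniteDimensional ℝ F]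
    {T : F → E →L[ℝ] E} {u₀ : F} (hT : ∀ᶠ u in 𝓝 u₀, ContDiffAt ℝ ∞ T u) {v₀ : E} {a : ℝ}
    (hv : T u₀ v₀ = a • v₀) (hv₀ : v₀ ≠ 0)
    (hsimple : ∀ w (b : ℝ), T u₀ w = a • w + b • v₀ → ∃ c : ℝ, w = c • v₀) :
    ∃ (v : F → E) (l : F → ℝ), v u₀ = v₀ ∧ l u₀ = a ∧
      ∀ᶠ u in 𝓝 u₀, ContDiffAt ℝ ∞ v u ∧ ContDiffAt ℝ ∞ l u ∧ T u (v u) = l u • v u ∧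
        v u ≠ 0 := by
  have : CompleteSpace (F × (E × ℝ)) := FiniteDimensional.complete ℝ _
  obtain ⟨ℓ, hℓ⟩ := SeparatingDual.exists_eq_one (R := ℝ) hv₀
  -- Keeping the parameter as first component turns the inverse function theorem into the implicit
  -- one. The equation `ℓ w = 1` fixes the scale of the eigenvector and balances the unknown
  -- eigenvalue.
  let G : F × (E × ℝ) → F × (E × ℝ) := fun z => (z.1, T z.1 z.2.1 - z.2.2 • z.2.1, ℓ z.2.1 - 1)
  have hG : ∀ᶠ z in 𝓝 (u₀, v₀, a), ContDiffAt ℝ ∞ G z := by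
    have h1 : ∀ᶠ z : F × (E × ℝ) in 𝓝 (u₀, v₀, a), ContDiffAt ℝ ∞ T z.1 :=
      (continuous_fst.tendsto (u₀, v₀, a)).eventually hT
    filter_upwards [h1] with z hz
    have h2 : ContDiffAt ℝ ∞ (fun z : F × (E × ℝ) => z.2.1) z :=
      contDiffAt_fst.comp z contDiffAt_snd
    have h3 : ContDiffAt ℝ ∞ (fun z : F × (E × ℝ) => z.2.2) z :=
      contDiffAt_snd.comp z contDiffAt_snd
    exact contDiffAt_fst.prodMk ((((hz.comp z contDiffAt_fst).clm_apply h2).sub (h3.smul h2)).prodMk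
      ((ℓ.contDiff.contDiffAt.comp z h2).sub contDiffAt_const))
  let L : F × (E × ℝ) →L[ℝ] F × (E × ℝ) := fderiv ℝ G (u₀, v₀, a)
  have hGL : HasFDerivAt G L (u₀, v₀, a) :=
    (hG.self_of_nhds.differentiableAt (by simp)).hasFDerivAt
  have hLapp : ∀ (w : E) (b : ℝ) (y : F), L (y, w, b) =
      (y, T u₀ w + fderiv ℝ T u₀ y v₀ - (a • w + b • v₀), ℓ w) := by
    intro w b y
    have hT0 : HasFDerivAt T (fderiv ℝ T u₀) u₀ :=
      (hT.self_of_nhds.differentiableAt (by simp)).hasFDerivAt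
    have e1 : HasFDerivAt (fun z : F × (E × ℝ) => z.1) (ContinuousLinearMap.fst ℝ F (E × ℝ))
        (u₀, v₀, a) := hasFDerivAt_fst
    have e2 : HasFDerivAt (fun z : F × (E × ℝ) => z.2.1)
        ((ContinuousLinearMap.fst ℝ E ℝ).comp (ContinuousLinearMap.snd ℝ F (E × ℝ)))
        (u₀, v₀, a) := hasFDerivAt_fst.comp (u₀, v₀, a) hasFDerivAt_snd
    have e3 : HasFDerivAt (fun z : F × (E × ℝ) => z.2.2)
        ((ContinuousLinearMap.snd ℝ E ℝ).comp (ContinuousLinearMap.snd ℝ F (E × ℝ)))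
        (u₀, v₀, a) := hasFDerivAt_snd.comp (u₀, v₀, a) hasFDerivAt_snd
    have e4 : HasFDerivAt (fun z : F × (E × ℝ) => T z.1)
        ((fderiv ℝ T u₀).comp (ContinuousLinearMap.fst ℝ F (E × ℝ))) (u₀, v₀, a) :=
      HasFDerivAt.comp (u₀, v₀, a) (g := T) hT0 e1
    have e5 := e1.prodMk (((e4.clm_apply e2).sub (e3.smul e2)).prodMk
      ((ℓ.hasFDerivAt.comp (u₀, v₀, a) e2).sub_const 1))
    have e6 : L = _ := HasFDerivAt.unique hGL e5
    rw [e6]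
    simp [add_comm]
  -- A kernel vector has `y = 0` and `(T u₀ - a) w = b • v₀`. Simplicity makes `w` a multiple of
  -- `v₀`, the normalisation makes it zero, and then `b = 0`. In finite dimension injectivity
  -- suffices.
  have hinj : Function.Injective (L : F × (E × ℝ) →ₗ[ℝ] F × (E × ℝ)) := by
    rw [← LinearMap.ker_eq_bot, LinearMap.ker_eq_bot']
    rintro ⟨y, w, b⟩ h0
    have h1 : L (y, w, b) = 0 := h0
    rw [hLapp] at h1
    simp only [Prod.mk_eq_zero] at h1
    obtain ⟨rfl, h2, h3⟩ := h1
    simp only [map_zero, zero_apply, add_zero] at h2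
    obtain ⟨c, rfl⟩ := hsimple w b (sub_eq_zero.1 h2)
    have hc : c = 0 := by simpa [hℓ] using h3
    subst hc
    have hb : b = 0 := by simpa [hv₀] using h2
    simp [hb]
  let Le : (F × (E × ℝ)) ≃L[ℝ] (F × (E × ℝ)) :=
    (LinearEquiv.ofInjectiveEndo (L : F × (E × ℝ) →ₗ[ℝ] F × (E × ℝ)) hinj).toContinuousLinearEquiv
  have hLe : (Le : F × (E × ℝ) →L[ℝ] F × (E × ℝ)) = L :=
    ContinuousLinearMap.ext fun _ => rfl
  rw [← hLe] at hGL
  obtain ⟨R, hR0, hRG, -, hRs⟩ := exists_openPartialHomeomorph_of_hasFDerivAt hG hGL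
  have hG0 : R (u₀, v₀, a) = (u₀, 0, 0) := by
    rw [hRG]
    simp [G, hv, hℓ]
  have hmem : (u₀, (0 : E), (0 : ℝ)) ∈ R.target := hG0 ▸ R.map_source hR0
  have hι : Continuous fun u : F => (u, (0 : E), (0 : ℝ)) := by fun_prop
  have hev : ∀ᶠ u in 𝓝 u₀, (u, (0 : E), (0 : ℝ)) ∈ R.target :=
    hι.continuousAt.eventually_mem (R.open_target.mem_nhds hmem)
  have hs0 : R.symm (u₀, 0, 0) = (u₀, v₀, a) := by rw [← hG0, R.left_inv hR0]
  refine ⟨fun u => (R.symm (u, 0, 0)).2.1, fun u => (R.symm (u, 0, 0)).2.2, by simp [hs0],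
    by simp [hs0], ?_⟩
  filter_upwards [hev] with u hu
  have h1 : ContDiffAt ℝ ∞ (fun u : F => R.symm (u, 0, 0)) u :=
    (hRs _ hu).comp u (contDiffAt_id.prodMk contDiffAt_const)
  have h2 : G (R.symm (u, 0, 0)) = (u, 0, 0) := by rw [← hRG, R.right_inv hu]
  simp only [G, Prod.mk.injEq] at h2
  obtain ⟨h3, h4, h5⟩ := h2
  rw [h3] at h4
  refine ⟨contDiffAt_fst.comp u (contDiffAt_snd.comp u h1),
    contDiffAt_snd.comp u (contDiffAt_snd.comp u h1), sub_eq_zero.1 h4, fun h6 => ?_⟩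
  rw [h6] at h5
  simp at h5

/-! ### Smooth local eigenframes -/

section Eigenframe

variable {M : Type*} [TopologicalSpace M] [ChartedSpace E3 M] [IsManifold (𝓡 3) ∞ M]
  {e : OpenPartialHomeomorph M E3} {x : M} {h : Metric M} {K : EndField M}
  {p : Fin 3 → M → ℝ}

theorem IsOrderedEigenvalues.exists_eigenbasis (hp : IsOrderedEigenvalues K p) (x : M) :
    ∃ b : Module.Basis (Fin 3) ℝ (TangentSpace (𝓡 3) x), ∀ A, K x (b A) = p A x • b A := by
  choose v hv using fun A => ((hp x).2 A).exists_hasEigenvector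
  have hv1 : ∀ A, K x (v A) = p A x • v A := fun A => (hv A).apply_eq_smul
  let b := basisOfLinearIndependentOfCardEqFinrank
    (hp.linearIndependent hv1 fun A => (hv A).2)
    (show Fintype.card (Fin 3) = Module.finrank ℝ E3 by simp)
  have hb : ∀ A, b A = v A :=
    congrFun (coe_basisOfLinearIndependentOfCardEqFinrank _ _)
  exact ⟨b, fun A => by rw [hb, hv1]⟩

theorem IsOrderedEigenvalues.repr_end_apply
    {b : Module.Basis (Fin 3) ℝ (TangentSpace (𝓡 3) x)} (hb : ∀ A, K x (b A) = p A x • b A)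
    (v : TangentSpace (𝓡 3) x) (A : Fin 3) : b.repr (K x v) A = p A x * b.repr v A := by
  conv_lhs => rw [← b.sum_repr v]
  simp only [map_sum, map_smul, hb, Finsupp.coe_finsetSum, Finset.sum_apply, Finsupp.smul_apply,
    Module.Basis.repr_self, smul_eq_mul]
  simp [Finsupp.single_apply, mul_comm]

theorem IsOrderedEigenvalues.exists_eq (hp : IsOrderedEigenvalues K p)
    {v : TangentSpace (𝓡 3) x} (hv0 : v ≠ 0) {a : ℝ} (hv : K x v = a • v) : ∃ A, a = p A x := by
  obtain ⟨b, hb⟩ := hp.exists_eigenbasis x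
  by_contra hne
  push Not at hne
  refine hv0 (b.ext_elem_iff.2 fun A => ?_)
  have h1 := repr_end_apply hb v A
  rw [hv, map_smul, Finsupp.smul_apply, smul_eq_mul] at h1
  have h2 : (a - p A x) * b.repr v A = 0 := by linarith
  simpa using (mul_eq_zero.1 h2).resolve_left (sub_ne_zero.2 (hne A))

/-- In an eigenbasis the components other than `A` are multiplied by `p A - p B ≠ 0`, so they vanish
for `v` and then for `w`. Allowing the term `c • v` excludes generalised eigenvectors too, as
`exists_smooth_eigenpair` requires. -/
theorem IsOrderedEigenvalues.simple (hp : IsOrderedEigenvalues K p) {A : Fin 3}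
    {v w : TangentSpace (𝓡 3) x} (hv0 : v ≠ 0) (hv : K x v = p A x • v) {c : ℝ}
    (hw : K x w = p A x • w + c • v) : ∃ c : ℝ, w = c • v := by
  obtain ⟨b, hb⟩ := hp.exists_eigenbasis x
  have h1 : ∀ B, B ≠ A → b.repr v B = 0 := by
    intro B hBA
    have h1 := repr_end_apply hb v B
    rw [hv, map_smul, Finsupp.smul_apply, smul_eq_mul] at h1
    have h2 : (p A x - p B x) * b.repr v B = 0 := by linarith
    exact (mul_eq_zero.1 h2).resolve_left (sub_ne_zero.2 (hp.ne x hBA.symm))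
  have h2 : ∀ B, B ≠ A → b.repr w B = 0 := by
    intro B hBA
    have h2 := repr_end_apply hb w B
    rw [hw, map_add, map_smul, map_smul, Finsupp.add_apply, Finsupp.smul_apply, Finsupp.smul_apply,
      smul_eq_mul, smul_eq_mul, h1 B hBA] at h2
    have h3 : (p A x - p B x) * b.repr w B = 0 := by linarith
    exact (mul_eq_zero.1 h3).resolve_left (sub_ne_zero.2 (hp.ne x hBA.symm))
  have h3 : b.repr v A ≠ 0 := by
    intro h3
    refine hv0 (b.ext_elem_iff.2 fun B => ?_)
    by_cases hBA : B = A
    · simpa [hBA] using h3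
    · simpa using h1 B hBA
  refine ⟨b.repr w A / b.repr v A, b.ext_elem_iff.2 fun B => ?_⟩
  rw [map_smul, Finsupp.smul_apply, smul_eq_mul]
  by_cases hBA : B = A
  · rw [hBA]
    field_simp
  · rw [h1 B hBA, h2 B hBA, mul_zero]

/-- The matrix of `K` in a chart, as a function on the model space. -/
def endExpr (e : OpenPartialHomeomorph M E3) (K : EndField M) (u : E3) : E3 →L[ℝ] E3 :=
  ∑ i, ∑ j, endComp e K i j (e.symm u) •
    (EuclideanSpace.proj i : E3 →L[ℝ] ℝ).smulRight (EuclideanSpace.single j (1 : ℝ) : E3)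

theorem contDiffAt_endExpr (hK : SmoothEndField K) (he : e ∈ IsManifold.maximalAtlas (𝓡 3) ∞ M)
    (hx : x ∈ e.source) : ContDiffAt ℝ ∞ (endExpr e K) (e x) :=
  ContDiffAt.sum fun i _ => ContDiffAt.sum fun j _ =>
    ((smoothAt_endComp hK he hx i j).contDiffAt he hx).smul contDiffAt_const

theorem endExpr_chartEquiv (he : e ∈ IsManifold.maximalAtlas (𝓡 3) ∞ M) (hx : x ∈ e.source)
    (v : TangentSpace (𝓡 3) x) :
    endExpr e K (e x) (chartEquiv he hx v) = chartEquiv he hx (K x v) := by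
  ext k
  rw [← coordCovec_eq he hx k (K x v), coordCovec_end_apply he hx]
  simp only [endExpr, sum_apply, smul_apply, ContinuousLinearMap.smulRight_apply,
    e.left_inv hx, coordCovec_eq he hx]
  simp [Finset.sum_apply, Pi.single_apply, mul_comm]

/-- The vector field with the given components in a chart. -/
def fieldOfExpr (e : OpenPartialHomeomorph M E3) (w : E3 → E3) : VField M := fun y =>
  ∑ i, w (e y) i • coordVec e i y

theorem chartEquiv_fieldOfExpr (he : e ∈ IsManifold.maximalAtlas (𝓡 3) ∞ M) (hx : x ∈ e.source)
    (w : E3 → E3) : chartEquiv he hx (fieldOfExpr e w x) = w (e x) := by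
  ext k
  simp only [fieldOfExpr, map_sum, map_smul, coordVec_eq he hx,
    ContinuousLinearEquiv.apply_symm_apply]
  simp [Finset.sum_apply, Pi.single_apply]

theorem smoothVFieldAt_fieldOfExpr (he : e ∈ IsManifold.maximalAtlas (𝓡 3) ∞ M)
    (hx : x ∈ e.source) {w : E3 → E3} (hw : ContDiffAt ℝ ∞ w (e x)) :
    SmoothVFieldAt (fieldOfExpr e w) x := by
  have h1 : ∀ i : Fin 3, SmoothVFieldAt (fun y => w (e y) i • coordVec e i y) x := by
    intro i
    have h2 : ContDiffAt ℝ ∞ (fun u => w u i) (e x) :=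
      (EuclideanSpace.proj i : E3 →L[ℝ] ℝ).contDiff.contDiffAt.comp _ hw
    exact SmoothVFieldAt.smul (h2.contMDiffAt.comp x (contMDiffAt_chart he hx))
      (smoothVFieldAt_coordVec he hx i)
  have h3 : fieldOfExpr e w = fun y => w (e y) 0 • coordVec e 0 y + w (e y) 1 • coordVec e 1 y +
      w (e y) 2 • coordVec e 2 y := by
    funext y
    simp [fieldOfExpr, Fin.sum_univ_three]
  rw [h3]
  exact ((h1 0).add (h1 1)).add (h1 2)

/-- Near every point there are smooth eigenvector fields. -/
theorem exists_isEigenframeNear (hK : SmoothEndField K) (hp : IsOrderedEigenvalues K p) (x : M) :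
    ∃ X : Fin 3 → VField M, ∀ᶠ y in 𝓝 x, IsEigenframeNear K p X y := by
  let e := chartAt E3 x
  have he : e ∈ IsManifold.maximalAtlas (𝓡 3) ∞ M := IsManifold.chart_mem_maximalAtlas x
  have hx : x ∈ e.source := mem_chart_source E3 x
  have hsrc : ∀ᶠ y in 𝓝 x, y ∈ e.source := e.open_source.mem_nhds hx
  have hcont : Tendsto e (𝓝 x) (𝓝 (e x)) := e.continuousAt hx
  have hT : ∀ᶠ u in 𝓝 (e x), ContDiffAt ℝ ∞ (endExpr e K) u := by
    filter_upwards [e.open_target.mem_nhds (e.map_source hx)] with u hu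
    have := contDiffAt_endExpr hK he (e.map_target hu)
    rwa [e.right_inv hu] at this
  obtain ⟨b, hb⟩ := hp.exists_eigenbasis x
  have hT' : ∀ w, endExpr e K (e x) w = chartEquiv he hx (K x ((chartEquiv he hx).symm w)) := by
    intro w
    rw [← endExpr_chartEquiv he hx, ContinuousLinearEquiv.apply_symm_apply]
  choose w l hw0 hl0 hwl using fun A => exists_smooth_eigenpair (v₀ := chartEquiv he hx (b A))
    (a := p A x) hT (by rw [endExpr_chartEquiv, hb, map_smul])
    (by simpa using b.ne_zero A) (fun w c hw => by
      rw [hT', ← (chartEquiv he hx).symm.injective.eq_iff] at hw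
      simp only [map_add, map_smul, ContinuousLinearEquiv.symm_apply_apply] at hw
      obtain ⟨c', hc'⟩ := hp.simple (b.ne_zero A) (hb A) hw
      exact ⟨c', by rw [← map_smul, ← hc', ContinuousLinearEquiv.apply_symm_apply]⟩)
  have hall := hcont.eventually (eventually_all.2 hwl)
  have hlc : ∀ A, ContinuousAt (l A) (e x) := fun A => (hwl A).self_of_nhds.2.1.continuousAt
  have hl01 : ∀ᶠ y in 𝓝 x, l 0 (e y) < l 1 (e y) := hcont.eventually
    ((hlc 0).eventually_lt (hlc 1) (by rw [hl0, hl0]; exact (hp x).1.1))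
  have hl12 : ∀ᶠ y in 𝓝 x, l 1 (e y) < l 2 (e y) := hcont.eventually
    ((hlc 1).eventually_lt (hlc 2) (by rw [hl0, hl0]; exact (hp x).1.2))
  have hgood : ∀ᶠ y in 𝓝 x, y ∈ e.source ∧ ∀ A, ContDiffAt ℝ ∞ (w A) (e y) ∧
      fieldOfExpr e (w A) y ≠ 0 ∧
      K y (fieldOfExpr e (w A) y) = p A y • fieldOfExpr e (w A) y := by
    filter_upwards [hsrc, hall, hl01, hl12] with y hy hA h01 h12
    have h1 : ∀ A, fieldOfExpr e (w A) y ≠ 0 := by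
      intro A h0
      have := chartEquiv_fieldOfExpr he hy (w A)
      rw [h0, map_zero] at this
      exact (hA A).2.2.2 this.symm
    have h2 : ∀ A, K y (fieldOfExpr e (w A) y) = l A (e y) • fieldOfExpr e (w A) y := by
      intro A
      apply (chartEquiv he hy).injective
      rw [← endExpr_chartEquiv, map_smul, chartEquiv_fieldOfExpr, (hA A).2.2.1]
    -- The perturbed eigenvalues are eigenvalues of K, hence `l A = p (s A)`. By continuity they are
    -- still ordered, so `s` is a strictly increasing self-map of three indices, that is, the
    -- identity.
    choose s hs using fun A => hp.exists_eq (h1 A) (h2 A)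
    have hmono : ∀ {A B : Fin 3}, p A y < p B y → A < B := by
      intro A B hAB
      obtain ⟨⟨q1, q2⟩, -⟩ := hp y
      fin_cases A <;> fin_cases B <;> simp at hAB ⊢ <;> linarith
    rw [hs 0, hs 1] at h01
    rw [hs 1, hs 2] at h12
    have g1 := hmono h01
    have g2 := hmono h12
    have hsA : ∀ A, s A = A := by
      intro A
      fin_cases A <;> simp <;> omega
    exact ⟨hy, fun A => ⟨(hA A).1, h1 A, by rw [h2 A, hs A, hsA]⟩⟩
  refine ⟨fun A => fieldOfExpr e (w A), ?_⟩
  filter_upwards [hgood.eventually_nhds] with y hy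
  exact ⟨fun A => smoothVFieldAt_fieldOfExpr he hy.self_of_nhds.1 (hy.self_of_nhds.2 A).1,
    hy.mono fun z hz A => (hz.2 A).2.2, fun A => (hy.self_of_nhds.2 A).2.1⟩

/-- Normalising an eigenframe. -/
theorem IsEigenframeNear.normalize {X : Fin 3 → VField M} (hX : IsEigenframeNear K p X x)
    (h : Metric M) :
    IsEigenframeNear K p (fun A y => (√(h.inner y (X A y) (X A y)))⁻¹ • X A y) x := by
  refine ⟨fun A => SmoothVFieldAt.smul ?_ (hX.smooth A), ?_, fun A => ?_⟩
  · have hpos := hX.inner_pos h A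
    exact ContMDiffAt.comp (g := fun t : ℝ => (√t)⁻¹) x
      ((contDiffAt_id.sqrt hpos.ne').inv (Real.sqrt_pos.2 hpos).ne').contMDiffAt
      (smoothAt_inner h (hX.smooth A) (hX.smooth A))
  · filter_upwards [hX.eig] with y hy A
    rw [map_smul, hy A, smul_comm]
  · exact smul_ne_zero (inv_ne_zero (Real.sqrt_pos.2 (hX.inner_pos h A)).ne') (hX.ne_zero A)

/-- Near every point there is a smooth frame of unit eigenvectors. -/
theorem exists_isUnitEigenframeOn (h : Metric M) (hK : SmoothEndField K)
    (hp : IsOrderedEigenvalues K p) (x : M) :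
    ∃ (U : Set M) (X : Fin 3 → VField M), IsOpen U ∧ x ∈ U ∧ IsUnitEigenframeOn h K p X U ∧
      ∀ y ∈ U, IsEigenframeNear K p X y := by
  obtain ⟨X, hX⟩ := exists_isEigenframeNear hK hp x
  obtain ⟨U, hU, hUo, hxU⟩ := eventually_nhds_iff.1 hX
  refine ⟨U, fun A y => (√(h.inner y (X A y) (X A y)))⁻¹ • X A y, hUo, hxU, fun A => ⟨fun y hy =>
    (((hU y hy).normalize h).smooth A).contMDiffWithinAt, fun y hy =>
    ⟨((hU y hy).normalize h).eig.self_of_nhds A, ?_⟩⟩, fun y hy => (hU y hy).normalize h⟩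
  have hpos := (hU y hy).inner_pos h A
  simp only [map_smul, smul_apply, smul_eq_mul]
  have h1 := Real.sq_sqrt hpos.le
  have h2 := (Real.sqrt_pos.2 hpos).ne'
  field_simp
  linarith

theorem smoothAt_eigenvalue (h : Metric M) (hK : SmoothEndField K)
    (hp : IsOrderedEigenvalues K p) (x : M) (A : Fin 3) : SmoothAt (p A) x := by
  obtain ⟨X, hX⟩ := exists_isEigenframeNear hK hp x
  exact hX.self_of_nhds.smoothAt_eigenvalue hK h A

theorem IsOrderedEigenvalues.trace_eq (hp : IsOrderedEigenvalues K p) (x : M) :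
    LinearMap.trace ℝ _ (K x : Module.End ℝ (TangentSpace (𝓡 3) x)) = ∑ A, p A x := by
  obtain ⟨b, hb⟩ := hp.exists_eigenbasis x
  rw [LinearMap.trace_eq_matrix_trace ℝ b]
  simp [Matrix.trace, LinearMap.toMatrix_apply, hb]

theorem IsOrderedEigenvalues.trace_sq_eq (hp : IsOrderedEigenvalues K p) (x : M) :
    LinearMap.trace ℝ _ ((K x ∘L K x : TangentSpace (𝓡 3) x →L[ℝ] TangentSpace (𝓡 3) x) :
      Module.End ℝ (TangentSpace (𝓡 3) x)) = ∑ A, p A x ^ 2 := by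
  obtain ⟨b, hb⟩ := hp.exists_eigenbasis x
  rw [LinearMap.trace_eq_matrix_trace ℝ b]
  simp [Matrix.trace, LinearMap.toMatrix_apply, hb, pow_two]

end Eigenframe

/-! ### Adapted charts -/

section Straightening

/-- The projection of `ℝ³` that kills the last coordinate. -/
def dropLast : E3 →L[ℝ] E3 :=
  ContinuousLinearMap.id ℝ E3 -
    (EuclideanSpace.proj 2 : E3 →L[ℝ] ℝ).smulRight (EuclideanSpace.single 2 (1 : ℝ) : E3)

theorem dropLast_apply (w : E3) : dropLast w = w - w 2 • EuclideanSpace.single 2 (1 : ℝ) := by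
  simp [dropLast]

theorem norm_dropLast_le (w : E3) : ‖dropLast w‖ ≤ ‖w‖ := by
  rw [EuclideanSpace.norm_eq, EuclideanSpace.norm_eq]
  refine Real.sqrt_le_sqrt (Finset.sum_le_sum fun i _ => ?_)
  rw [dropLast_apply]
  fin_cases i <;> simp [sq_nonneg]

/-- A function whose derivative in the last direction vanishes near the origin depends on the
first two coordinates only. -/
theorem eventually_eq_comp_dropLast {Q : E3 → ℝ} (hQ : ∀ᶠ u in 𝓝 0, DifferentiableAt ℝ Q u)
    (hQ2 : ∀ᶠ u in 𝓝 0, fderiv ℝ Q u (EuclideanSpace.single 2 (1 : ℝ)) = 0) :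
    ∀ᶠ w in 𝓝 0, Q w = Q (dropLast w) := by
  obtain ⟨r, hr, hball⟩ := Metric.eventually_nhds_iff_ball.1 (hQ.and hQ2)
  filter_upwards [Metric.ball_mem_nhds (0 : E3) hr] with w hw
  let c : ℝ → E3 := fun t => dropLast w + t • (w 2 • EuclideanSpace.single 2 (1 : ℝ))
  have hc : ∀ t ∈ Set.Icc (0 : ℝ) 1, c t ∈ Metric.ball (0 : E3) r := by
    intro t ht
    have h1 : c t = (1 - t) • dropLast w + t • w := by
      simp only [c, dropLast_apply]
      module
    rw [h1]
    refine (convex_ball (0 : E3) r) ?_ hw (by linarith [ht.2]) ht.1 (by ring)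
    rw [mem_ball_zero_iff] at hw ⊢
    exact (norm_dropLast_le w).trans_lt hw
  have hd : ∀ t ∈ Set.Icc (0 : ℝ) 1, HasDerivAt (fun t => Q (c t)) 0 t := by
    intro t ht
    have h1 : HasDerivAt c (w 2 • (EuclideanSpace.single 2 (1 : ℝ) : E3)) t := by
      have h0 := ((hasDerivAt_id t).smul_const
        (w 2 • (EuclideanSpace.single 2 (1 : ℝ) : E3))).const_add (dropLast w)
      rw [one_smul] at h0
      exact h0
    have h2 := (hball _ (hc t ht)).1.hasFDerivAt.comp_hasDerivAt t h1
    rw [map_smul, (hball _ (hc t ht)).2, smul_zero] at h2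
    exact h2
  have h3 := constant_of_has_deriv_right_zero (f := fun t => Q (c t))
    (fun t ht => (hd t ht).continuousAt.continuousWithinAt)
    (fun t ht => (hd t ⟨ht.1, ht.2.le⟩).hasDerivWithinAt) 1 (by simp)
  have h4 : c 1 = w := by simp [c, dropLast_apply]
  have h5 : c 0 = dropLast w := by simp [c]
  simpa only [h4, h5] using h3

/-- A change of coordinates that straightens the plane field spanned by the last coordinate vector
and `∂_1 + Q ∂_0`, where `Q` does not depend on the last coordinate. -/
theorem exists_planar_straightening {Q : E3 → ℝ} (hQ : ∀ᶠ u in 𝓝 0, ContDiffAt ℝ ∞ Q u)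
    (hQ0 : Q 0 = 0)
    (hQ2 : ∀ᶠ u in 𝓝 0, fderiv ℝ Q u (EuclideanSpace.single 2 (1 : ℝ)) = 0) :
    ∃ g : E3 → E3, (∀ᶠ u in 𝓝 0, ContDiffAt ℝ ∞ g u) ∧
      HasFDerivAt g (ContinuousLinearEquiv.refl ℝ E3 : E3 →L[ℝ] E3) 0 ∧
      ∀ᶠ u in 𝓝 0, ∀ z : E3, (z 0 = Q u * z 1 → fderiv ℝ g u z 0 = 0) ∧
        fderiv ℝ g u z 1 = z 1 ∧ fderiv ℝ g u z 2 = z 2 := by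
  obtain ⟨f, hf, -, hfd, hfV⟩ := exists_flowBox (x₀ := (0 : E3))
    (V := fun u => (EuclideanSpace.single 1 (1 : ℝ) : E3) + Q u • EuclideanSpace.single 0 (1 : ℝ))
    (hQ.mono fun u hu => contDiffAt_const.add (hu.smul contDiffAt_const))
    (ContinuousLinearEquiv.refl ℝ E3) (EuclideanSpace.proj 1 : E3 →L[ℝ] ℝ)
    (v := EuclideanSpace.single 1 (1 : ℝ)) (by simp) (by simp [hQ0])
  have hP : Tendsto dropLast (𝓝 (0 : E3)) (𝓝 0) := by
    simpa using dropLast.continuous.tendsto (0 : E3)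
  -- Only coordinate `0` is changed, to the component `0` of `f` on the plane `w 2 = 0`. That
  -- component is constant along `∂_1 + Q ∂_0`, and `Q` does not see the last coordinate, so the new
  -- coordinate is annihilated by both directions of the plane field.
  let G : E3 → E3 := fun w =>
    w + (f (dropLast w) 0 - w 0) • (EuclideanSpace.single 0 (1 : ℝ) : E3)
  have hGd : ∀ u, DifferentiableAt ℝ f (dropLast u) → HasFDerivAt G
      (ContinuousLinearMap.id ℝ E3 +
        ((EuclideanSpace.proj 0 : E3 →L[ℝ] ℝ).comp ((fderiv ℝ f (dropLast u)).comp dropLast) -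
          (EuclideanSpace.proj 0 : E3 →L[ℝ] ℝ)).smulRight
            (EuclideanSpace.single 0 (1 : ℝ) : E3)) u := by
    intro u hu
    have h1 := hu.hasFDerivAt.comp u dropLast.hasFDerivAt
    have h2 := (EuclideanSpace.proj 0 : E3 →L[ℝ] ℝ).hasFDerivAt.comp u h1
    exact (hasFDerivAt_id u).add
      ((h2.sub (EuclideanSpace.proj 0 : E3 →L[ℝ] ℝ).hasFDerivAt).smul_const _)
  refine ⟨G, ?_, ?_, ?_⟩
  · filter_upwards [hP.eventually hf] with u hu
    have h1 : ContDiffAt ℝ ∞ (fun w => f (dropLast w) 0) u :=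
      (EuclideanSpace.proj 0 : E3 →L[ℝ] ℝ).contDiff.contDiffAt.comp u
        (hu.comp u dropLast.contDiff.contDiffAt)
    exact contDiffAt_id.add ((h1.sub
      (EuclideanSpace.proj 0 : E3 →L[ℝ] ℝ).contDiff.contDiffAt).smul contDiffAt_const)
  · have h1 := hGd 0 (by rw [map_zero]; exact hfd.differentiableAt)
    rw [map_zero, hfd.fderiv] at h1
    convert h1 using 1
    refine ContinuousLinearMap.ext fun w => ?_
    simp [dropLast_apply]
  · filter_upwards [hP.eventually hf, hP.eventually hfV,
      eventually_eq_comp_dropLast (hQ.mono fun u hu => hu.differentiableAt (by simp)) hQ2]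
      with u hu huV huQ z
    rw [(hGd u (hu.differentiableAt (by simp))).fderiv]
    refine ⟨fun hz => ?_, by simp, by simp⟩
    have h1 : dropLast z = z 1 • ((EuclideanSpace.single 1 (1 : ℝ) : E3) +
        Q (dropLast u) • EuclideanSpace.single 0 (1 : ℝ)) := by
      rw [← huQ, dropLast_apply]
      ext i
      fin_cases i <;> simp [hz, mul_comm]
    have h2 : fderiv ℝ f (dropLast u) (dropLast z) = z 1 • EuclideanSpace.single 1 (1 : ℝ) := by
      rw [h1, map_smul, huV]
    simp [h2]

end Straightening

/-! ### Frobenius argument and existence of adapted charts -/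

section AdaptedChart

variable {M : Type*} [TopologicalSpace M] [ChartedSpace E3 M] [IsManifold (𝓡 3) ∞ M]
  {e : OpenPartialHomeomorph M E3} {x : M} {h : Metric M} {K : EndField M}
  {p : Fin 3 → M → ℝ}

/-- A chart in which a given vector field is the last coordinate vector field, and a given basis
of a tangent space is the coordinate basis. -/
theorem exists_chart_straighten {Y : VField M} (hY : ∀ᶠ y in 𝓝 x, SmoothVFieldAt Y y)
    (b : Module.Basis (Fin 3) ℝ (TangentSpace (𝓡 3) x)) (hb : b 2 = Y x) {U : Set M}
    (hU : U ∈ 𝓝 x) :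
    ∃ e ∈ IsManifold.maximalAtlas (𝓡 3) ∞ M, x ∈ e.source ∧ e.source ⊆ U ∧ e x = 0 ∧
      (∀ A j, coordCovec e j x (b A) = if j = A then 1 else 0) ∧
      ∀ y ∈ e.source, ∀ j, coordCovec e j y (Y y) = if j = 2 then 1 else 0 := by
  let e := chartAt E3 x
  have he : e ∈ IsManifold.maximalAtlas (𝓡 3) ∞ M := IsManifold.chart_mem_maximalAtlas x
  have hx : x ∈ e.source := mem_chart_source E3 x
  have hcont : Tendsto e (𝓝 x) (𝓝 (e x)) := e.continuousAt hx
  have hsymm : Tendsto e.symm (𝓝 (e x)) (𝓝 x) := by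
    have := e.continuousAt_symm (e.map_source hx)
    rwa [ContinuousAt, e.left_inv hx] at this
  let D : E3 ≃L[ℝ] E3 :=
    ((EuclideanSpace.basisFun (Fin 3) ℝ).toBasis.equiv (b.map (chartEquiv he hx).toLinearEquiv)
      (Equiv.refl _)).toContinuousLinearEquiv
  have hD : ∀ A, D (EuclideanSpace.single A (1 : ℝ)) = chartEquiv he hx (b A) := by
    intro A
    have := (EuclideanSpace.basisFun (Fin 3) ℝ).toBasis.equiv_apply A
      (b.map (chartEquiv he hx).toLinearEquiv) (Equiv.refl _)
    simp only [OrthonormalBasis.coe_toBasis, EuclideanSpace.basisFun_apply, Equiv.refl_apply,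
      Module.Basis.map_apply] at this
    exact this
  have hV : ∀ᶠ u in 𝓝 (e x), ContDiffAt ℝ ∞ (coordExpr e Y) u := by
    filter_upwards [hsymm.eventually hY, e.open_target.mem_nhds (e.map_source hx)] with u hu hut
    have := contDiffAt_coordExpr he (e.map_target hut) hu
    rwa [e.right_inv hut] at this
  obtain ⟨g, hg, hg0, hgd, hgV⟩ := exists_flowBox hV D (EuclideanSpace.proj 2 : E3 →L[ℝ] ℝ)
    (v := EuclideanSpace.single 2 (1 : ℝ)) (by simp) (by rw [hD, hb, coordExpr_apply he hx])
  obtain ⟨e', he', hx', hsub, hcomp⟩ := exists_chart_comp he hx hg hgd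
    (inter_mem hU (hcont.eventually hgV))
  refine ⟨e', he', hx', fun y hy => (hsub hy).2.1, by rw [(hcomp x hx').1, hg0], fun A j => ?_,
    fun y hy j => ?_⟩
  · rw [(hcomp x hx').2 hx, hgd.fderiv, ← hD]
    simp
  · have h1 : fderiv ℝ g (e y) (coordExpr e Y (e y)) = EuclideanSpace.single 2 1 := (hsub hy).2.2
    rw [(hcomp y hy).2 (hsub hy).1, ← coordExpr_apply he (hsub hy).1, h1]
    simp

/-- A chart adapted to an involutive pair of vector fields. -/
theorem exists_chart_of_involutive {Y Z : VField M} (hY : ∀ᶠ y in 𝓝 x, SmoothVFieldAt Y y)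
    (hZ : ∀ᶠ y in 𝓝 x, SmoothVFieldAt Z y)
    (b : Module.Basis (Fin 3) ℝ (TangentSpace (𝓡 3) x)) (hb1 : b 1 = Z x) (hb2 : b 2 = Y x)
    (hinv : ∀ᶠ y in 𝓝 x, ∃ β γ : ℝ,
      VectorField.mlieBracket (𝓡 3) Z Y y = β • Z y + γ • Y y) {U : Set M} (hU : U ∈ 𝓝 x) :
    ∃ e ∈ IsManifold.maximalAtlas (𝓡 3) ∞ M, x ∈ e.source ∧ e.source ⊆ U ∧
      ∀ y ∈ e.source, coordCovec e 0 y (Y y) = 0 ∧ coordCovec e 1 y (Y y) = 0 ∧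
        coordCovec e 0 y (Z y) = 0 := by
  obtain ⟨e, he, hx, hsub, hex, hbe, hYe⟩ := exists_chart_straighten hY b hb2
    (inter_mem hU (hY.and (hZ.and hinv)))
  have h0t : (0 : E3) ∈ e.target := hex ▸ e.map_source hx
  let f : Fin 3 → E3 → ℝ := fun j u => coordCovec e j (e.symm u) (Z (e.symm u))
  have hfe : ∀ {y}, y ∈ e.source → ∀ j, f j (e y) = coordCovec e j y (Z y) := fun hy j =>
    congrArg (fun z => coordCovec e j z (Z z)) (e.left_inv hy)
  have hf0 : ∀ j, f j 0 = if j = 1 then 1 else 0 := by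
    intro j
    rw [← hex, hfe hx, ← hb1, hbe]
  have hfs : ∀ u ∈ e.target, ∀ j, ContDiffAt ℝ ∞ (f j) u := by
    intro u hu j
    have hy := e.map_target hu
    have := SmoothAt.contDiffAt (contMDiffAt_coordCovec he hy (hsub hy).2.2.1 j) he hy
    rwa [e.right_inv hu] at this
  -- Here `Y` is the last coordinate field, so the components of `[Z, Y]` are minus the last partial
  -- derivatives of those of `Z`. For `j ≠ 2` the term `γ • Y` does not contribute, and the same `β`
  -- serves both indices.
  have hfd : ∀ u ∈ e.target, ∃ β : ℝ, ∀ j, j ≠ 2 →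
      fderiv ℝ (f j) u (EuclideanSpace.single 2 (1 : ℝ)) = -β * f j u := by
    intro u hu
    have hy := e.map_target hu
    obtain ⟨-, hYs, hZs, β, γ, hβ⟩ := hsub hy
    refine ⟨β, fun j hj => ?_⟩
    have h1 := coordCovec_mlieBracket he hy hZs hYs j
    have h2 : ∀ i, pderiv e i (fun y => coordCovec e j y (Y y)) (e.symm u) = 0 := by
      intro i
      rw [pderiv_congr hy (g := fun _ => 0), pderiv_const]
      filter_upwards [e.open_source.mem_nhds hy] with z hz
      simp [hYe z hz, hj]
    simp only [h2, hYe _ hy, hβ, map_add, map_smul, hj, if_false, smul_eq_mul] at h1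
    simp only [Fin.sum_univ_three] at h1
    have h3 : pderiv e 2 (fun y => coordCovec e j y (Z y)) (e.symm u) =
        fderiv ℝ (f j) u (EuclideanSpace.single 2 (1 : ℝ)) := by
      unfold pderiv
      rw [e.right_inv hu]
    simp at h1
    rw [← h3]
    simp only [f]
    linarith
  have ht0 : ∀ᶠ u in 𝓝 (0 : E3), u ∈ e.target := e.open_target.mem_nhds h0t
  have hne : ∀ᶠ u in 𝓝 (0 : E3), f 1 u ≠ 0 :=
    (hfs 0 h0t 1).continuousAt.eventually_ne (by simp [hf0])
  -- Both components satisfy the same linear equation in the last variable, so their quotient is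
  -- independent of it. It vanishes at the origin because `Z` is the coordinate vector with index
  -- `1` there.
  obtain ⟨g, hg, hgd, hgz⟩ := exists_planar_straightening (Q := fun u => f 0 u / f 1 u)
    (by filter_upwards [ht0, hne] with u hu hu1 using (hfs u hu 0).div (hfs u hu 1) hu1)
    (by simp [hf0]) (by
      filter_upwards [ht0, hne] with u hu hu1
      obtain ⟨β, hβ⟩ := hfd u hu
      have hd := fun j => (hfs u hu j).differentiableAt (by simp)
      have h1 := ((hd 0).hasFDerivAt.mul' ((hasDerivAt_inv hu1).comp_hasFDerivAt u
        (hd 1).hasFDerivAt))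
      have h2 : HasFDerivAt (fun u => f 0 u / f 1 u) _ u := h1
      rw [h2.fderiv]
      simp [hβ 0 (by decide), hβ 1 (by decide)]
      field_simp
      ring)
  rw [← hex] at hg hgd hgz hne
  have hcont : Tendsto e (𝓝 x) (𝓝 (e x)) := e.continuousAt hx
  obtain ⟨e', he', hx', hsub', hcomp⟩ := exists_chart_comp he hx hg hgd
    (hcont.eventually (hgz.and hne))
  refine ⟨e', he', hx', fun y hy => (hsub (hsub' hy).1).1, fun y hy => ?_⟩
  obtain ⟨hye, hyz, hy1⟩ := hsub' hy
  have hc := (hcomp y hy).2 hye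
  refine ⟨?_, ?_, ?_⟩
  · rw [hc]
    refine (hyz _).1 ?_
    rw [← coordCovec_eq he hye, ← coordCovec_eq he hye, hYe y hye, hYe y hye]
    simp
  · rw [hc, (hyz _).2.1, ← coordCovec_eq he hye, hYe y hye]
    simp
  · rw [hc]
    refine (hyz _).1 ?_
    rw [← coordCovec_eq he hye, ← coordCovec_eq he hye, ← hfe hye, ← hfe hye]
    field_simp

/-- Supplies the first diagonal entry of K in `IsEigenframeNear.isUpperTriangularAt`, where only the
eigenvectors `X 1` and `X 2` have controlled positions. -/
theorem sum_endComp_diag (hp : IsOrderedEigenvalues K p)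
    (he : e ∈ IsManifold.maximalAtlas (𝓡 3) ∞ M) (hx : x ∈ e.source) :
    ∑ i, endComp e K i i x = ∑ i, p i x := by
  rw [← hp.trace_eq x, LinearMap.trace_eq_matrix_trace ℝ (coordBasis he hx)]
  simp [Matrix.trace, LinearMap.toMatrix_apply, coordBasis_apply, coordBasis_repr, endComp]

/-- Eigenvector fields in triangular position make the matrix of `K` triangular. -/
theorem IsEigenframeNear.isUpperTriangularAt {X : Fin 3 → VField M} (hX : IsEigenframeNear K p X x)
    (hp : IsOrderedEigenvalues K p) (he : e ∈ IsManifold.maximalAtlas (𝓡 3) ∞ M)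
    (hx : x ∈ e.source) (h20 : coordCovec e 0 x (X 2 x) = 0) (h21 : coordCovec e 1 x (X 2 x) = 0)
    (h10 : coordCovec e 0 x (X 1 x) = 0) : IsUpperTriangularAt e K p x := by
  have key : ∀ A j, ∑ i, coordCovec e i x (X A x) * endComp e K i j x =
      p A x * coordCovec e j x (X A x) := by
    intro A j
    rw [← coordCovec_end_apply he hx, hX.eig.self_of_nhds A, map_smul, smul_eq_mul]
  simp only [Fin.sum_univ_three] at key
  have h22 : coordCovec e 2 x (X 2 x) ≠ 0 := by
    intro h22
    refine hX.ne_zero 2 (tangent_ext he hx fun j => ?_)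
    fin_cases j <;> simpa
  have k20 : endComp e K 2 0 x = 0 := by simpa [h20, h21, h22] using key 2 0
  have k21 : endComp e K 2 1 x = 0 := by simpa [h20, h21, h22] using key 2 1
  have k22 : endComp e K 2 2 x = p 2 x := by
    have := key 2 2
    rw [h20, h21, mul_comm (p 2 x)] at this
    simpa [h22] using this
  -- Otherwise `X 1` would be a multiple of the last coordinate vector, which is an eigenvector for
  -- `p 2`, contrary to `p 1 ≠ p 2`.
  have h11 : coordCovec e 1 x (X 1 x) ≠ 0 := by
    intro h11
    have h12 : coordCovec e 2 x (X 1 x) = 0 := by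
      have := key 1 2
      rw [h10, h11, k22] at this
      have h3 : (p 2 x - p 1 x) * coordCovec e 2 x (X 1 x) = 0 := by linarith
      exact (mul_eq_zero.1 h3).resolve_left (sub_ne_zero.2 (hp.ne x (by decide)))
    refine hX.ne_zero 1 (tangent_ext he hx fun j => ?_)
    fin_cases j <;> simpa
  have k10 : endComp e K 1 0 x = 0 := by simpa [h10, k20, h11] using key 1 0
  have k11 : endComp e K 1 1 x = p 1 x := by
    have := key 1 1
    rw [h10, k21, mul_comm (p 1 x)] at this
    simpa [h11] using this
  have htr := sum_endComp_diag hp he hx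
  simp only [Fin.sum_univ_three, k11, k22] at htr
  refine ⟨fun i => ?_, k10, k20, k21⟩
  fin_cases i
  · simpa using htr
  · exact k11
  · exact k22

/-- A chart in which the matrix of `K` is triangular is adapted. -/
theorem isTriangularChart_of_isUpperTriangularAt (hK : SmoothEndField K)
    (hp : IsOrderedEigenvalues K p) (hps : ∀ y A, SmoothAt (p A) y)
    (he : e ∈ IsManifold.maximalAtlas (𝓡 3) ∞ M)
    (ht : ∀ y ∈ e.source, IsUpperTriangularAt e K p y) : IsTriangularChart e K p := by
  have heig : ∀ y ∈ e.source, ∀ A, K y (triFrame e K p A y) = p A y • triFrame e K p A y :=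
    fun y hy => (ht y hy).end_triFrame he hy hp
  have hne : ∀ y ∈ e.source, ∀ A, triFrame e K p A y ≠ 0 := by
    intro y hy A h0
    have := coordCovec_triFrame (K := K) (p := p) he hy A A
    rw [h0, map_zero] at this
    fin_cases A <;> simp at this
  have hli : ∀ y ∈ e.source, LinearIndependent ℝ fun A => triFrame e K p A y :=
    fun y hy => hp.linearIndependent (heig y hy) (hne y hy)
  refine ⟨⟨fun {y} hy => hli y hy, fun {y} hy => ?_, fun A y hy => ?_⟩, heig⟩
  · exact (LinearIndependent.span_eq_top_of_card_eq_finrank (hli y hy)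
      (show Fintype.card (Fin 3) = Module.finrank ℝ E3 by simp)).ge
  · refine ContMDiffAt.contMDiffWithinAt ?_
    have hv := smoothVFieldAt_coordVec he hy
    have hs := smoothAt_endComp hK he hy
    have hpd : ∀ A B, A ≠ B → SmoothAt (fun z => 1 / (p A z - p B z)) y := fun A B hAB =>
      (smoothAt_const 1).div ((hps y A).sub (hps y B)) (sub_ne_zero.2 (hp.ne y hAB))
    have h01 := hpd 0 1 (by decide)
    have h02 := hpd 0 2 (by decide)
    have h12 := hpd 1 2 (by decide)
    fin_cases A
    · exact ((hv 0).add (SmoothVFieldAt.smul (h01.mul (hs 0 1)) (hv 1))).add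
        (SmoothVFieldAt.smul (h02.mul ((hs 0 2).add ((h01.mul (hs 0 1)).mul (hs 1 2)))) (hv 2))
    · exact (hv 1).add (SmoothVFieldAt.smul (h12.mul (hs 1 2)) (hv 2))
    · exact hv 2

/-- Around every point there is an adapted chart. -/
theorem exists_isTriangularChart (hd : IsVacuumData h K) (hp : IsOrderedEigenvalues K p) (x : M) :
    ∃ e ∈ IsManifold.maximalAtlas (𝓡 3) ∞ M, x ∈ e.source ∧ IsTriangularChart e K p := by
  obtain ⟨U, X, hUo, hxU, hXU, hXn⟩ := exists_isUnitEigenframeOn h hd.smooth hp x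
  have hUx : U ∈ 𝓝 x := hUo.mem_nhds hxU
  -- The vanishing obstruction enters here: the bracket of the second and third eigenvector fields
  -- has no component along the first, which is the Frobenius condition.
  have hinv : ∀ y ∈ U, ∃ β γ : ℝ,
      VectorField.mlieBracket (𝓡 3) (X 1) (X 2) y = β • X 1 y + γ • X 2 y := by
    intro y hy
    let b := (hXn y hy).basis hp
    let γ : Fin 3 → Fin 3 → Fin 3 → ℝ := fun A B C =>
      b.repr (VectorField.mlieBracket (𝓡 3) (X B) (X C) y) A
    have hγ : IsStructureCoeffAt X γ y := by
      intro B C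
      have := b.sum_repr (VectorField.mlieBracket (𝓡 3) (X B) (X C) y)
      simp only [b, (hXn y hy).basis_apply hp] at this
      exact this.symm
    have h0 := pow_eq_zero_iff (two_ne_zero) |>.1
      (hd.obstruction_eq_zero p hp U X hUo hXU y hy γ hγ)
    refine ⟨γ 1 1 2, γ 2 1 2, ?_⟩
    rw [hγ 1 2, Fin.sum_univ_three, h0, zero_smul, zero_add]
  obtain ⟨e, he, hxe, hsub, hcov⟩ := exists_chart_of_involutive (Y := X 2) (Z := X 1)
    (by filter_upwards [hUx] with y hy using (hXn y hy).smooth 2)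
    (by filter_upwards [hUx] with y hy using (hXn y hy).smooth 1)
    ((hXn x hxU).basis hp) ((hXn x hxU).basis_apply hp 1) ((hXn x hxU).basis_apply hp 2)
    (by filter_upwards [hUx] with y hy using hinv y hy) hUx
  exact ⟨e, he, hxe, isTriangularChart_of_isUpperTriangularAt hd.smooth hp
    (smoothAt_eigenvalue h hd.smooth hp) he fun y hy =>
      (hXn y (hsub hy)).isUpperTriangularAt hp he hy (hcov y hy).1 (hcov y hy).2.1
        (hcov y hy).2.2⟩

/-- In an adapted chart, initial data on the singularity define Fournodavlos and Luk data. -/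
theorem isFLDataOn_cFun (hd : IsVacuumData h K) (hp : IsOrderedEigenvalues K p)
    (he : e ∈ IsManifold.maximalAtlas (𝓡 3) ∞ M) (ht : IsTriangularChart e K p) :
    IsFLDataOn e p (cFun e h K p) where
  smooth_p i y _ := (smoothAt_eigenvalue h hd.smooth hp y i).contMDiffWithinAt
  smooth_c i j y hy := by
    refine ContMDiffAt.contMDiffWithinAt ?_
    have hs := smoothAt_endComp hd.smooth he hy
    have hps := smoothAt_eigenvalue h hd.smooth hp y
    have hc : ∀ A, SmoothAt (cDiag e h K p A) y := fun A =>
      smoothAt_inner h ((ht.isEigenframeNear hy).smooth A) ((ht.isEigenframeNear hy).smooth A)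
    have hdiv : ∀ {f : M → ℝ}, SmoothAt f y → ∀ A B, A ≠ B →
        SmoothAt (fun z => f z / (p A z - p B z)) y := fun hf A B hAB =>
      hf.div ((hps A).sub (hps B)) (sub_ne_zero.2 (hp.ne y hAB))
    have h12 : SmoothAt (c12 e h K p) y := (hdiv (hc 1) 1 0 (by decide)).mul (hs 0 1)
    have h23 : SmoothAt (c23 e h K p) y := (hdiv (hc 2) 2 1 (by decide)).mul (hs 1 2)
    have h13 : SmoothAt (c13 e h K p) y := (hdiv (hc 2) 2 0 (by decide)).mul
      ((hs 0 2).add (((hdiv (smoothAt_const 1) 2 1 (by decide)).mul (hs 0 1)).mul (hs 1 2)))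
    fin_cases i <;> fin_cases j
    exacts [hc 0, h12, h13, h12, hc 1, h23, h13, h23, hc 2]
  symm i j y _ := by fin_cases i <;> fin_cases j <;> rfl
  ordered y _ := (hp y).1
  pos i y hy := by
    rw [cFun_diag]
    exact (ht.isEigenframeNear hy).inner_pos h i
  kasner y _ := ⟨by rw [← hp.trace_eq, hd.trace_eq], by rw [← hp.trace_sq_eq, hd.trace_sq_eq]⟩
  momentum y hy := (momentumCondAt_iff_divFreeAt ht he hy hd.smooth hd.symm hp).2
    (hd.div_eq_zero y)

end AdaptedChart

end QuiescentData

end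

/-! ### The proposition -/

theorem mainTheorem4 {M : Type*} [TopologicalSpace M] [T2Space M] [SecondCountableTopology M]
    [ChartedSpace QuiescentData.E3 M] [IsManifold (𝓡 3) ∞ M]
    (h : QuiescentData.Metric M) (K : QuiescentData.EndField M)
    (p : Fin 3 → M → ℝ) (hp : QuiescentData.IsOrderedEigenvalues K p) :
    (QuiescentData.IsVacuumData h K → ∀ x₀ : M,
      ∃ e ∈ IsManifold.maximalAtlas (𝓡 3) ∞ M, x₀ ∈ e.source ∧
        QuiescentData.IsTriangularChart e K p ∧
        QuiescentData.IsFLDataOn e p (QuiescentData.cFun e h K p)) ∧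
    (QuiescentData.SmoothEndField K → QuiescentData.IsSymm h K →
      ∀ e ∈ IsManifold.maximalAtlas (𝓡 3) ∞ M, QuiescentData.IsTriangularChart e K p →
        ∀ x ∈ e.source,
          (QuiescentData.MomentumCondAt e p (QuiescentData.cFun e h K p) x ↔
            QuiescentData.DivFreeAt h K x)) := by
  refine ⟨fun hd x₀ => ?_, fun hKs hK e he ht x hx =>
    QuiescentData.momentumCondAt_iff_divFreeAt ht he hx hKs hK hp⟩
  obtain ⟨e, he, hxe, ht⟩ := QuiescentData.exists_isTriangularChart hd hp x₀
  exact ⟨e, he, hxe, ht, QuiescentData.isFLDataOn_cFun hd hp he ht⟩
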